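/- **Theorem 4.1.** Let $P$ be a Markov kernel on a measurable space $\mathsf X$ with invariant probability measure $\pi$, and let $\{X_n,\ n\ge 0\}$ be a Markov chain on a probability space $(\Omega,\mathcal F,\mathbb P)$ with transition kernel $P$ with respect to some filtration $\{\mathcal F_n\}$; the law of $X_0$ is arbitrary. For a function $W\ge 1$ write $\mathcal L_W$ for the measurable $f:\mathsf X\to\mathbb R$ with $\sup_x|f(x)|/W(x)<\infty$, and $\|\mu-\nu\|_W=\sup_{|f|\le W}|\mu(f)-\nu(f)|$ for probability measures $\mu,\nu$. Assume: * (GE) there is a measurable $V:\mathsf X\to[1,\infty)$ with $\sup_{n\ge 0}\mathbb E(V(X_n))<\infty$ such that for every $\beta\in(0,1]$ there are $C<\infty$ and $\rho\in(0,1)$ with $\|P^n(x,\cdot)-\pi\|_{V^\beta}\le C\rho^nV^\beta(x)$ for all $n\ge 0$, $x\in\mathsf X$; * (A3) $w:\mathbb R\to[0,1]$ is even, vanishes outside $[-1,1]$, $w(0)=1$ and $w(1)=0$; moreover there is $L<\infty$ with $|1-w(u)|\le L|u|$ for all $u\in\mathbb R$ (for instance, $w$ is Lipschitz); * $\delta\in[0,1/4)$,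 $h\in\mathcal L_{V^\delta}$, $\pi(h)=0$ and $\sigma^2:=\sum_{\ell\in\mathbb Z}\gamma_\ell=1$, where $\gamma_\ell=\int (h(x)-\pi(h))\,P^{\ell}h(x)\,\pi(dx)$ for $\ell\ge 0$ and $\gamma_{-\ell}=\gamma_\ell$. For $n\ge1$ put $\hat\pi_n(h)=n^{-1}\sum_{k=1}^nh(X_k)$, $\gamma_{n,\ell}=\gamma_{n,-\ell}=n^{-1}\sum_{j=1}^{n-\ell}(h(X_j)-\hat\pi_n(h))(h(X_{j+\ell})-\hat\pi_n(h))$ for $0\le \ell\le n-1$, and $$\Gamma_n^2(h)=\sum_{k=-n+1}^{n-1}w\!\left(\frac{k}{c_n}\right)\gamma_{n,k}.$$ 1. If $(c_n)_{n\ge 1}$ are positive numbers with $c_n\to\infty$ and $c_n=o(n)$, then there is a finite constant $K$, not depending on $n$, such that for all $n\ge1$ the variable $(\Gamma_n^2(h)-1)^2$ is integrable and $$\mathbb E^{1/2}\left[(\Gamma_n^2(h)-1)^2\right]\le K\left(\frac1{c_n}+\sqrt{\frac{c_n}{n}}\right).$$ 2. In particular, if $c_n=n^{1/3}$ for all $n\ge1$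 (or $c_n=\lfloor n^{1/3}\rfloor$ for all $n\ge 1$), then for some finite $K$ and all $n\ge1$ the variable $(\Gamma_n^2(h)-1)^2$ is integrable and $\mathbb E^{1/2}[(\Gamma_n^2(h)-1)^2]\le K n^{-1/3}$. -/

import Mathlib

open MeasureTheory ProbabilityTheory Filter
open scoped ENNReal

noncomputable section

namespace LagWindow

variable {Ω X : Type*} [MeasurableSpace Ω] [MeasurableSpace X]

/-- `X₀, X₁, …` is a Markov chain with transition kernel `P` with respect to the filtration `ℱ`:
it is adapted, and `E (f (Xₙ₊₁) | ℱₙ) = ∫ f(z) P(Xₙ, dz)` almost surely for all measurable `f ≥ 0`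
(with `f (Xₙ₊₁)` integrable, so that the real conditional expectation makes sense).
The law of `X₀` is arbitrary. -/
structure IsMarkovChain (μ : Measure Ω) (ℱ : Filtration ℕ ‹MeasurableSpace Ω›)
    (P : Kernel X X) (ξ : ℕ → Ω → X) : Prop where
  adapted : Adapted ℱ ξ
  condExp_succ : ∀ (n : ℕ) (f : X → ℝ), Measurable f → (∀ x, 0 ≤ f x) →
    Integrable (fun ω => f (ξ (n + 1) ω)) μ →
    μ[(fun ω => f (ξ (n + 1) ω)) | ℱ n] =ᵐ[μ] fun ω => ∫ z, f z ∂(P (ξ n ω))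

/-- `‖μ - ν‖_W = sup { |μ(f) - ν(f)| : |f| ≤ W }`, with values in `[0, ∞]`. The supremum is over
the measurable `f` that both measures integrate; this class contains all bounded `f` with
`|f| ≤ W`, so the supremum is infinite whenever the integral of `W` against `|μ - ν|` is. -/
def weightedDist (W : X → ℝ) (μ ν : Measure X) : ℝ≥0∞ :=
  ⨆ f ∈ {f : X → ℝ | Measurable f ∧ Integrable f μ ∧ Integrable f ν ∧ ∀ x, |f x| ≤ W x},
    ENNReal.ofReal |∫ x, f x ∂μ - ∫ x, f x ∂ν|

/-- The geometric ergodicity assumption with weight function `V : X → [1, ∞)`. -/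
structure GeometricErgodic (μ : Measure Ω) (P : Kernel X X) (π : Measure X) (ξ : ℕ → Ω → X)
    (V : X → ℝ) : Prop where
  measurable : Measurable V
  one_le : ∀ x, 1 ≤ V x
  moment : ⨆ n, ∫⁻ ω, ENNReal.ofReal (V (ξ n ω)) ∂μ < ∞
  rate : ∀ β : ℝ, 0 < β → β ≤ 1 → ∃ C ρ : ℝ, 0 < ρ ∧ ρ < 1 ∧
    ∀ (n : ℕ) (x : X),
      weightedDist (fun y => V y ^ β) ((P ^ n) x) π ≤ ENNReal.ofReal (C * ρ ^ n * V x ^ β)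

/-- `h ∈ L_W`: `h` is measurable and `sup_x |h x| / W x < ∞`. -/
def MemWeighted (W : X → ℝ) (h : X → ℝ) : Prop :=
  Measurable h ∧ BddAbove (Set.range fun x => |h x| / W x)

/-- `γ_ℓ(P, h) = ∫ (h(x) - π(h)) P^ℓ h(x) π(dx)` for `ℓ ≥ 0`. -/
def autocov (P : Kernel X X) (π : Measure X) (h : X → ℝ) (l : ℕ) : ℝ :=
  ∫ x, (h x - ∫ y, h y ∂π) * (∫ y, h y ∂((P ^ l) x)) ∂π

/-- The asymptotic variance `σ²_P(h) = ∑_{ℓ ∈ ℤ} γ_ℓ(P, h)`, where `γ_{-ℓ} = γ_ℓ`. -/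
def asympVar (P : Kernel X X) (π : Measure X) (h : X → ℝ) : ℝ :=
  ∑' l : ℤ, autocov P π h l.natAbs

/-- The empirical mean `n⁻¹ ∑_{k=1}^n h(X_k)`. -/
def empMean (h : X → ℝ) (ξ : ℕ → Ω → X) (n : ℕ) (ω : Ω) : ℝ :=
  (n : ℝ)⁻¹ * ∑ k ∈ Finset.Icc 1 n, h (ξ k ω)

/-- The sample autocovariance `γ_{n,ℓ}`, for `0 ≤ ℓ ≤ n - 1`. -/
def sampleAutocov (h : X → ℝ) (ξ : ℕ → Ω → X) (n l : ℕ) (ω : Ω) : ℝ :=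
  (n : ℝ)⁻¹ * ∑ j ∈ Finset.Icc 1 (n - l),
    (h (ξ j ω) - empMean h ξ n ω) * (h (ξ (j + l) ω) - empMean h ξ n ω)

/-- The lag-window estimator `Γ_n²(h) = ∑_{k=-n+1}^{n-1} w(k / c_n) γ_{n,k}`, where
`γ_{n,-k} = γ_{n,k}`. -/
def lagWindowEst (w : ℝ → ℝ) (c : ℕ → ℝ) (h : X → ℝ) (ξ : ℕ → Ω → X) (n : ℕ) (ω : Ω) : ℝ :=
  ∑ k ∈ Finset.Icc (-(n : ℤ) + 1) ((n : ℤ) - 1),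
    w ((k : ℝ) / c n) * sampleAutocov h ξ n k.natAbs ω

/-- Weight functions `w : ℝ → [0, 1]`, even, supported in `[-1, 1]`, with `w 0 = 1`, `w 1 = 0`. -/
structure IsWeight (w : ℝ → ℝ) : Prop where
  nonneg : ∀ u, 0 ≤ w u
  le_one : ∀ u, w u ≤ 1
  support : ∀ u, 1 < |u| → w u = 0
  even : ∀ u, w (-u) = w u
  at_zero : w 0 = 1
  at_one : w 1 = 0

end LagWindow

end

/-!
The estimator is a quadratic form in the variables `Y i = h (ξ i)`, and the mean square error is
the sum of a bias, of order `1 / c n`, and a variance, of order `c n / n`.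

*Variance.* Write `g s = P ^ s h`. For `i < j` the product `Y i * Y j` splits into
`Y i * g (j - i) (ξ i)`, its prediction at time `i`, and `Y i` times the prediction error of `Y j`,
which telescopes into the innovations `g s (ξ (m + 1)) - g (s + 1) (ξ m)`, `s = j - (m + 1)`, for
`i ≤ m < j` (`sum_sum_mul_sub_eq`). Summed over `i ≤ j` with coefficients `α i j`, the predictions
give an additive functional of the chain, whose variance is of order `n`
(`MixingChain.integral_sq_sum_comp_le`). The errors, sorted by `m`, form a martingale whose
increments are innovations times linear forms `∑ i ≤ m, α i j * Y i`. The innovations decay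
geometrically in `s`, and such a linear form with `N` nonzero coefficients has second moment of
order `N`, even against the weight `U ^ 2` by which the innovations are bounded
(`MixingChain.exists_integral_sq_mul_sq_sum_le`). By orthogonality the quadratic form has variance
of order `n * N` (`MixingChain.exists_integral_sq_quadForm_le`). This uses only double sums of
covariances; no fourth-order cumulants appear. Here `U = V ^ (1 / 4)`, so that products of four
functions dominated by `U` are integrable along the chain, and `h` is one of them as `δ < 1 / 4`.

*Centring.* Expanding the empirical mean turns the estimator into the band matrix form with
coefficients `w ((j - i) / c n)`, for which `N` is of order `c n`, plus a form with `N = n` whose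
coefficients are of order `c n / n` (`lagWindowEst_eq`). The same variance bound covers both.

*Bias.* `|1 - w u| ≤ L |u|` and the geometric decay of the autocovariances bound it by a multiple of
`1 / c n + 1 / n` (`IsWeight.abs_lagWeight_sum_sub_le`). No regularity of `w` away from the origin
enters.
-/

namespace LagWindow

/-! ### Geometric convergence in weighted norms -/

section Kernel

variable {X : Type*} [MeasurableSpace X]

theorem integrable_of_integral_min_le {ν : Measure X} [IsFiniteMeasure ν] {W : X → ℝ}
    (hW : Measurable W) (hpos : ∀ x, 0 ≤ W x) {B : ℝ}
    (hB : ∀ N : ℕ, ∫ x, min (W x) N ∂ν ≤ B) : Integrable W ν := by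
  refine ⟨hW.aestronglyMeasurable, ?_⟩
  rw [hasFiniteIntegral_iff_ofReal (ae_of_all _ hpos)]
  have hmono : Monotone fun (N : ℕ) x => ENNReal.ofReal (min (W x) N) := by
    intro N N' h x
    have : (N : ℝ) ≤ N' := by exact_mod_cast h
    exact ENNReal.ofReal_le_ofReal (min_le_min le_rfl this)
  have hsup : ∀ x, ENNReal.ofReal (W x) = ⨆ N : ℕ, ENNReal.ofReal (min (W x) N) := by
    intro x
    apply le_antisymm
    · obtain ⟨N, hN⟩ := exists_nat_ge (W x)
      exact le_iSup_of_le N (by rw [min_eq_left hN])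
    · exact iSup_le fun N => ENNReal.ofReal_le_ofReal (min_le_left _ _)
  simp_rw [hsup]
  rw [lintegral_iSup (fun N => (hW.min measurable_const).ennreal_ofReal) hmono]
  refine lt_of_le_of_lt (iSup_le fun N => ?_) (ENNReal.ofReal_lt_top (r := B))
  rw [← ofReal_integral_eq_lintegral_ofReal]
  · exact ENNReal.ofReal_le_ofReal (hB N)
  · refine Integrable.of_bound (C := N) (hW.min measurable_const).aestronglyMeasurable
      (ae_of_all _ fun x => ?_)
    rw [Real.norm_of_nonneg (le_min (hpos x) (Nat.cast_nonneg N))]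
    exact min_le_right _ _
  · exact ae_of_all _ fun x => le_min (hpos x) (Nat.cast_nonneg N)

theorem isMarkovKernel_pow (P : Kernel X X) [IsMarkovKernel P] : ∀ k : ℕ, IsMarkovKernel (P ^ k)
  | 0 => inferInstanceAs (IsMarkovKernel (Kernel.id : Kernel X X))
  | k + 1 => by
    have := isMarkovKernel_pow P k
    exact inferInstanceAs (IsMarkovKernel ((P ^ k) ∘ₖ P))

/-- Geometric convergence of `P ^ k` to `π` in `W`-norm, tested against integrals: every
measurable `f` with `|f| ≤ a W` satisfies `|P ^ k f - π f| ≤ a C ρ ^ k W`. In contrast to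
`weightedDist`, integrability of `W` under all the measures involved is part of the notion, so the
bound applies to every such `f`. -/
structure GeometricRate (P : Kernel X X) (π : Measure X) (W : X → ℝ) (C ρ : ℝ) : Prop where
  measurable : Measurable W
  one_le : ∀ x, 1 ≤ W x
  C_nonneg : 0 ≤ C
  rho_pos : 0 < ρ
  rho_lt_one : ρ < 1
  integrable : Integrable W π
  integrable_pow : ∀ (k : ℕ) (x : X), Integrable W ((P ^ k) x)
  rate : ∀ (f : X → ℝ) (a : ℝ), Measurable f → (∀ x, |f x| ≤ a * W x) → ∀ (k : ℕ) (x : X),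
    |∫ y, f y ∂((P ^ k) x) - ∫ y, f y ∂π| ≤ a * C * ρ ^ k * W x

theorem GeometricRate.mono {P : Kernel X X} {π : Measure X} {W : X → ℝ} {C ρ C' ρ' : ℝ}
    (hR : GeometricRate P π W C ρ) (hC : C ≤ C') (hρ : ρ ≤ ρ') (hρ' : ρ' < 1) :
    GeometricRate P π W C' ρ' where
  measurable := hR.measurable
  one_le := hR.one_le
  C_nonneg := hR.C_nonneg.trans hC
  rho_pos := hR.rho_pos.trans_le hρ
  rho_lt_one := hρ'
  integrable := hR.integrable
  integrable_pow := hR.integrable_pow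
  rate f a hf hfa k x := by
    have hW : 0 ≤ W x := zero_le_one.trans (hR.one_le x)
    have ha : 0 ≤ a := by
      have h1 := (abs_nonneg _).trans (hfa x)
      exact nonneg_of_mul_nonneg_left h1 (zero_lt_one.trans_le (hR.one_le x))
    refine (hR.rate f a hf hfa k x).trans ?_
    have := hR.rho_pos.le
    have hC' : 0 ≤ C' := hR.C_nonneg.trans hC
    have := mul_nonneg ha hC'
    gcongr

/-- The integrability of `W`, which `weightedDist` does not assert, follows by testing the
distance of `π` and `P ^ k x` against the truncations of `W`, starting from `P ^ 0 x = δ_x`. -/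
theorem GeometricRate.of_weightedDist {P : Kernel X X} [IsMarkovKernel P] {π : Measure X}
    [IsProbabilityMeasure π] {W : X → ℝ} {C ρ : ℝ} (hW : Measurable W) (h1 : ∀ x, 1 ≤ W x)
    (hρ : 0 < ρ) (hρ1 : ρ < 1)
    (hrate : ∀ (k : ℕ) (x : X),
      weightedDist W ((P ^ k) x) π ≤ ENNReal.ofReal (C * ρ ^ k * W x)) :
    GeometricRate P π W (max C 0) ρ := by
  have hW0 : ∀ x, 0 ≤ W x := fun x => zero_le_one.trans (h1 x)
  have := isMarkovKernel_pow P
  have key : ∀ (f : X → ℝ) (k : ℕ) (x : X), Measurable f → Integrable f ((P ^ k) x) →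
      Integrable f π → (∀ y, |f y| ≤ W y) →
      |∫ y, f y ∂((P ^ k) x) - ∫ y, f y ∂π| ≤ max C 0 * ρ ^ k * W x := by
    intro f k x hf hfk hfπ hfW
    have h2 : ENNReal.ofReal |∫ y, f y ∂((P ^ k) x) - ∫ y, f y ∂π|
        ≤ weightedDist W ((P ^ k) x) π :=
      le_iSup₂ (f := fun (f : X → ℝ) (_ : f ∈ {f : X → ℝ | Measurable f ∧
        Integrable f ((P ^ k) x) ∧ Integrable f π ∧ ∀ x, |f x| ≤ W x}) =>
        ENNReal.ofReal |∫ y, f y ∂((P ^ k) x) - ∫ y, f y ∂π|) f ⟨hf, hfk, hfπ, hfW⟩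
    have h3 : C * ρ ^ k * W x ≤ max C 0 * ρ ^ k * W x := by
      have := hW0 x
      gcongr
      exact le_max_left _ _
    have h4 := (h2.trans (hrate k x)).trans (ENNReal.ofReal_le_ofReal h3)
    refine (ENNReal.ofReal_le_ofReal_iff ?_).1 h4
    have := hW0 x
    positivity
  have hmin : ∀ N : ℕ, Measurable fun x => min (W x) N := fun N => hW.min measurable_const
  have habs : ∀ (N : ℕ) y, |min (W y) N| ≤ W y := fun N y => by
    rw [abs_of_nonneg (le_min (hW0 y) (Nat.cast_nonneg N))]
    exact min_le_left _ _
  have hint : ∀ (N : ℕ) (ν : Measure X) [IsFiniteMeasure ν],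
      Integrable (fun x => min (W x) N) ν := fun N ν _ =>
    Integrable.of_bound (C := N) (hmin N).aestronglyMeasurable (ae_of_all _ fun x => by
      rw [Real.norm_of_nonneg (le_min (hW0 x) (Nat.cast_nonneg N))]
      exact min_le_right _ _)
  have hπ : Integrable W π := by
    obtain ⟨x⟩ : Nonempty X := π.nonempty_of_neZero
    refine integrable_of_integral_min_le hW hW0 (B := W x + max C 0 * ρ ^ 0 * W x) fun N => ?_
    have h2 := key _ 0 x (hmin N) (hint N _) (hint N _) (habs N)
    have h3 : ∫ y, min (W y) N ∂((P ^ 0) x) = min (W x) N := by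
      rw [pow_zero]
      exact integral_dirac' _ _ (hmin N).stronglyMeasurable
    rw [h3] at h2
    have := (abs_le.1 h2).1
    have := min_le_left (W x) (N : ℝ)
    linarith
  have hk : ∀ (k : ℕ) (x : X), Integrable W ((P ^ k) x) := fun k x => by
    refine integrable_of_integral_min_le hW hW0
      (B := ∫ y, W y ∂π + max C 0 * ρ ^ k * W x) fun N => ?_
    have h2 := (abs_le.1 (key _ k x (hmin N) (hint N _) (hint N _) (habs N))).2
    have h3 := integral_mono (hint N π) hπ fun y => min_le_left _ _
    linarith
  refine ⟨hW, h1, le_max_right _ _, hρ, hρ1, hπ, hk, fun f a hf hfa k x => ?_⟩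
  have ha : 0 ≤ a := nonneg_of_mul_nonneg_left ((abs_nonneg _).trans (hfa x))
    (zero_lt_one.trans_le (h1 x))
  rcases ha.eq_or_lt with rfl | ha
  · have : f = 0 := funext fun y => by simpa using hfa y
    simp [this]
  have hbd : ∀ y, |a⁻¹ * f y| ≤ W y := fun y => by
    rw [abs_mul, abs_of_pos (inv_pos.2 ha), inv_mul_le_iff₀ ha]
    exact hfa y
  have hi : ∀ ν : Measure X, Integrable W ν → Integrable (fun y => a⁻¹ * f y) ν := fun ν hν =>
    hν.mono' (hf.const_mul _).aestronglyMeasurable (ae_of_all _ hbd)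
  have h2 := key _ k x (hf.const_mul a⁻¹) (hi _ (hk k x)) (hi _ hπ) hbd
  rw [integral_const_mul, integral_const_mul, ← mul_sub, abs_mul, abs_of_pos (inv_pos.2 ha),
    inv_mul_le_iff₀ ha] at h2
  linarith

section Rate

variable {P : Kernel X X} {π : Measure X} {W : X → ℝ} {C ρ : ℝ}

theorem GeometricRate.nonneg (hR : GeometricRate P π W C ρ) (x : X) : 0 ≤ W x :=
  zero_le_one.trans (hR.one_le x)

theorem GeometricRate.integral_nonneg (hR : GeometricRate P π W C ρ) : 0 ≤ ∫ x, W x ∂π :=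
  MeasureTheory.integral_nonneg hR.nonneg

theorem GeometricRate.integrable_of_le (hR : GeometricRate P π W C ρ) {f : X → ℝ} {a : ℝ}
    (hf : Measurable f) (hfa : ∀ x, |f x| ≤ a * W x) : Integrable f π :=
  (hR.integrable.const_mul a).mono' hf.aestronglyMeasurable (ae_of_all _ hfa)

theorem GeometricRate.integrable_pow_of_le (hR : GeometricRate P π W C ρ) {f : X → ℝ} {a : ℝ}
    (hf : Measurable f) (hfa : ∀ x, |f x| ≤ a * W x) (k : ℕ) (x : X) :
    Integrable f ((P ^ k) x) :=
  ((hR.integrable_pow k x).const_mul a).mono' hf.aestronglyMeasurable (ae_of_all _ hfa)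

theorem GeometricRate.abs_integral_le (hR : GeometricRate P π W C ρ) {f : X → ℝ} {a : ℝ}
    (hfa : ∀ x, |f x| ≤ a * W x) : |∫ x, f x ∂π| ≤ a * ∫ x, W x ∂π := by
  rw [← integral_const_mul, ← Real.norm_eq_abs]
  exact norm_integral_le_of_norm_le (hR.integrable.const_mul a) (ae_of_all _ hfa)

theorem measurable_integral_pow (P : Kernel X X) (k : ℕ) {f : X → ℝ} (hf : Measurable f) :
    Measurable fun x => ∫ y, f y ∂((P ^ k) x) :=
  (hf.stronglyMeasurable.integral_kernel (κ := P ^ k)).measurable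

theorem GeometricRate.abs_integral_pow_le (hR : GeometricRate P π W C ρ) {f : X → ℝ} {a : ℝ}
    (hf : Measurable f) (hfa : ∀ x, |f x| ≤ a * W x) (k : ℕ) (x : X) :
    |∫ y, f y ∂((P ^ k) x)| ≤ a * (C + ∫ y, W y ∂π) * W x := by
  have h1 := hR.rate f a hf hfa k x
  have h2 := hR.abs_integral_le hfa
  have hW := hR.one_le x
  have ha : 0 ≤ a := nonneg_of_mul_nonneg_left ((abs_nonneg _).trans (hfa x))
    (zero_lt_one.trans_le hW)
  have h3 : a * C * ρ ^ k * W x ≤ a * C * 1 * W x := by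
    have := hR.C_nonneg
    have := hR.nonneg x
    gcongr
    exact pow_le_one₀ hR.rho_pos.le hR.rho_lt_one.le
  have h4 : a * ∫ y, W y ∂π ≤ a * (∫ y, W y ∂π) * W x :=
    le_mul_of_one_le_right (mul_nonneg ha hR.integral_nonneg) hW
  have h5 := abs_sub_abs_le_abs_sub (∫ y, f y ∂((P ^ k) x)) (∫ y, f y ∂π)
  linarith

theorem GeometricRate.integral_pow_succ (hR : GeometricRate P π W C ρ) {f : X → ℝ} {a : ℝ}
    (hf : Measurable f) (hfa : ∀ x, |f x| ≤ a * W x) (k : ℕ) (x : X) :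
    ∫ y, f y ∂((P ^ (k + 1)) x) = ∫ y, ∫ z, f z ∂(P y) ∂((P ^ k) x) := by
  have h := hR.integrable_pow_of_le hf hfa (k + 1) x
  have e : P ^ (k + 1) = P ∘ₖ (P ^ k) := pow_succ' P k
  rw [e] at h ⊢
  exact Kernel.integral_comp h

theorem GeometricRate.integral_pow_succ' (hR : GeometricRate P π W C ρ) {f : X → ℝ} {a : ℝ}
    (hf : Measurable f) (hfa : ∀ x, |f x| ≤ a * W x) (k : ℕ) (x : X) :
    ∫ y, f y ∂((P ^ (k + 1)) x) = ∫ y, ∫ z, f z ∂((P ^ k) y) ∂(P x) := by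
  have h := hR.integrable_pow_of_le hf hfa (k + 1) x
  have e : P ^ (k + 1) = (P ^ k) ∘ₖ P := pow_succ P k
  rw [e] at h ⊢
  exact Kernel.integral_comp h

end Rate

end Kernel

/-! ### The Markov property and decay of covariances -/

section Markov

variable {Ω X : Type*} [mΩ : MeasurableSpace Ω] [MeasurableSpace X]
  {μ : Measure Ω} {ℱ : Filtration ℕ mΩ} {P : Kernel X X}
  {π : Measure X} {ξ : ℕ → Ω → X} {W : X → ℝ} {C ρ : ℝ}

theorem IsMarkovChain.measurable (hc : IsMarkovChain μ ℱ P ξ) (n : ℕ) : Measurable (ξ n) :=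
  (hc.adapted n).mono (ℱ.le n) le_rfl

theorem IsMarkovChain.stronglyMeasurable_comp (hc : IsMarkovChain μ ℱ P ξ) {f : X → ℝ}
    (hf : Measurable f) {m n : ℕ} (hmn : m ≤ n) :
    StronglyMeasurable[ℱ n] fun ω => f (ξ m ω) :=
  ((hf.comp (hc.adapted m)).stronglyMeasurable).mono (ℱ.mono hmn)

/-- The Markov property for signed functions dominated by `W`: the structure `IsMarkovChain` only
speaks of nonnegative ones, and `f + a W` is one. -/
theorem IsMarkovChain.condExp_succ_of_le (hc : IsMarkovChain μ ℱ P ξ)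
    (hR : GeometricRate P π W C ρ) (hint : ∀ m, Integrable (fun ω => W (ξ m ω)) μ)
    {f : X → ℝ} {a : ℝ} (hf : Measurable f) (hfa : ∀ x, |f x| ≤ a * W x) (n : ℕ) :
    μ[(fun ω => f (ξ (n + 1) ω)) | ℱ n] =ᵐ[μ] fun ω => ∫ z, f z ∂(P (ξ n ω)) := by
  have hW := hR.measurable
  have hfi : Integrable (fun ω => f (ξ (n + 1) ω)) μ :=
    ((hint (n + 1)).const_mul a).mono' (hf.comp (hc.measurable _)).aestronglyMeasurable
      (ae_of_all _ fun ω => hfa _)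
  have haW : Integrable (fun ω => a * W (ξ (n + 1) ω)) μ := (hint (n + 1)).const_mul a
  have h1 := hc.condExp_succ n (fun x => f x + a * W x) (hf.add (hW.const_mul a))
    (fun x => by have := (abs_le.1 (hfa x)).1; linarith) (hfi.add haW)
  have h2 := hc.condExp_succ n (fun x => a * W x) (hW.const_mul a)
    (fun x => (abs_nonneg _).trans (hfa x)) haW
  have h3 := condExp_sub (m := ℱ n) (hfi.add haW) haW
  have e : (fun ω => f (ξ (n + 1) ω)) =
      ((fun ω => f (ξ (n + 1) ω)) + fun ω => a * W (ξ (n + 1) ω)) -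
        fun ω => a * W (ξ (n + 1) ω) := by
    simp
  rw [e]
  refine h3.trans ?_
  filter_upwards [h1, h2] with ω h1 h2
  have hiP : ∀ g : X → ℝ, Integrable g ((P ^ 1) (ξ n ω)) → Integrable g (P (ξ n ω)) := by
    intro g hg
    rwa [pow_one] at hg
  rw [Pi.sub_apply, h2]
  refine (congrArg (· - _) h1).trans ?_
  rw [integral_add (hiP _ (hR.integrable_pow_of_le hf hfa 1 _))
    ((hiP _ (hR.integrable_pow 1 _)).const_mul a)]
  simp

theorem integrable_mul_of_le {G : Ω → ℝ} {Y : Ω → X} (hR : GeometricRate P π W C ρ)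
    (hY : Measurable Y) (hG : AEStronglyMeasurable G μ)
    (hGW : Integrable (fun ω => G ω * W (Y ω)) μ)
    {f : X → ℝ} {a : ℝ} (hf : Measurable f) (hfa : ∀ x, |f x| ≤ a * W x) :
    Integrable (fun ω => G ω * f (Y ω)) μ := by
  refine (hGW.abs.const_mul a).mono' (hG.mul (hf.comp hY).aestronglyMeasurable)
    (ae_of_all _ fun ω => ?_)
  rw [Real.norm_eq_abs, abs_mul, abs_mul, abs_of_nonneg (hR.nonneg _)]
  calc |G ω| * |f (Y ω)| ≤ |G ω| * (a * W (Y ω)) := by gcongr; exact hfa _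
    _ = a * (|G ω| * W (Y ω)) := by ring

variable [IsFiniteMeasure μ]

theorem IsMarkovChain.integral_mul_succ (hc : IsMarkovChain μ ℱ P ξ)
    (hR : GeometricRate P π W C ρ) (hint : ∀ m, Integrable (fun ω => W (ξ m ω)) μ)
    {n : ℕ} {G : Ω → ℝ} (hG : StronglyMeasurable[ℱ n] G)
    (hGW : ∀ m, Integrable (fun ω => G ω * W (ξ m ω)) μ)
    {f : X → ℝ} {a : ℝ} (hf : Measurable f) (hfa : ∀ x, |f x| ≤ a * W x) :
    ∫ ω, G ω * f (ξ (n + 1) ω) ∂μ = ∫ ω, G ω * ∫ z, f z ∂(P (ξ n ω)) ∂μ := by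
  have hfi : Integrable (fun ω => f (ξ (n + 1) ω)) μ :=
    ((hint (n + 1)).const_mul a).mono' (hf.comp (hc.measurable _)).aestronglyMeasurable
      (ae_of_all _ fun ω => hfa _)
  have hGf := integrable_mul_of_le hR (hc.measurable (n + 1))
    (hG.mono (ℱ.le n)).aestronglyMeasurable (hGW (n + 1)) hf hfa
  have h1 := condExp_mul_of_stronglyMeasurable_left (m := ℱ n) hG hGf hfi
  have h2 := hc.condExp_succ_of_le hR hint hf hfa n
  calc ∫ ω, G ω * f (ξ (n + 1) ω) ∂μ
      = ∫ ω, (μ[G * fun ω => f (ξ (n + 1) ω) | ℱ n]) ω ∂μ := (integral_condExp (ℱ.le n)).symm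
    _ = _ := by
      refine integral_congr_ae ?_
      filter_upwards [h1, h2] with ω h1 h2
      rw [h1, Pi.mul_apply, h2]

theorem IsMarkovChain.integral_mul_add (hc : IsMarkovChain μ ℱ P ξ)
    (hR : GeometricRate P π W C ρ) (hint : ∀ m, Integrable (fun ω => W (ξ m ω)) μ)
    {n : ℕ} {G : Ω → ℝ} (hG : StronglyMeasurable[ℱ n] G)
    (hGW : ∀ m, Integrable (fun ω => G ω * W (ξ m ω)) μ) (k : ℕ) :
    ∀ {f : X → ℝ} {a : ℝ}, Measurable f → (∀ x, |f x| ≤ a * W x) →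
    ∫ ω, G ω * f (ξ (n + k) ω) ∂μ = ∫ ω, G ω * ∫ z, f z ∂((P ^ k) (ξ n ω)) ∂μ := by
  induction k with
  | zero =>
    intro f a hf hfa
    refine integral_congr_ae (ae_of_all _ fun ω => ?_)
    have : (P ^ 0) (ξ n ω) = Measure.dirac (ξ n ω) := by rw [pow_zero]; rfl
    simp only [this, integral_dirac' _ _ hf.stronglyMeasurable, add_zero]
  | succ k ih =>
    intro f a hf hfa
    have h1 := hc.integral_mul_succ hR hint (n := n + k) (hG.mono (ℱ.mono (Nat.le_add_right n k)))
      hGW hf hfa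
    have hPf := measurable_integral_pow P 1 hf
    have hPfa := hR.abs_integral_pow_le hf hfa 1
    rw [pow_one] at hPf hPfa
    rw [← add_assoc, h1, ih hPf hPfa]
    exact integral_congr_ae (ae_of_all _ fun ω => by
      simp only [hR.integral_pow_succ hf hfa k])

/-- A functional of the past and a function of the state `k` steps later decorrelate at rate
`ρ ^ k`. -/
theorem IsMarkovChain.abs_integral_mul_sub_le (hc : IsMarkovChain μ ℱ P ξ)
    (hR : GeometricRate P π W C ρ) (hint : ∀ m, Integrable (fun ω => W (ξ m ω)) μ)
    {n : ℕ} {G : Ω → ℝ} (hG : StronglyMeasurable[ℱ n] G) (hGi : Integrable G μ)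
    (hGW : ∀ m, Integrable (fun ω => G ω * W (ξ m ω)) μ) (k : ℕ)
    {f : X → ℝ} {a : ℝ} (hf : Measurable f) (hfa : ∀ x, |f x| ≤ a * W x) :
    |∫ ω, G ω * f (ξ (n + k) ω) ∂μ - (∫ x, f x ∂π) * ∫ ω, G ω ∂μ|
      ≤ a * C * ρ ^ k * ∫ ω, |G ω| * W (ξ n ω) ∂μ := by
  rw [hc.integral_mul_add hR hint hG hGW k hf hfa, ← integral_const_mul, ← integral_sub]
  · rw [← integral_const_mul, ← Real.norm_eq_abs]
    refine norm_integral_le_of_norm_le ?_ (ae_of_all _ fun ω => ?_)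
    · refine Integrable.const_mul ?_ _
      refine (hGW n).abs.congr (ae_of_all _ fun ω => ?_)
      simp only [abs_mul, abs_of_nonneg (hR.nonneg _)]
    · have e : G ω * ∫ z, f z ∂((P ^ k) (ξ n ω)) - (∫ x, f x ∂π) * G ω
          = G ω * (∫ z, f z ∂((P ^ k) (ξ n ω)) - ∫ x, f x ∂π) := by ring
      rw [e, norm_mul, Real.norm_eq_abs, Real.norm_eq_abs]
      calc |G ω| * |∫ z, f z ∂((P ^ k) (ξ n ω)) - ∫ x, f x ∂π|
          ≤ |G ω| * (a * C * ρ ^ k * W (ξ n ω)) := by gcongr; exact hR.rate f a hf hfa k _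
        _ = _ := by ring
  · exact integrable_mul_of_le hR (hc.measurable n) (hG.mono (ℱ.le n)).aestronglyMeasurable
      (hGW n) (measurable_integral_pow P k hf) (hR.abs_integral_pow_le hf hfa k)
  · exact hGi.const_mul _

end Markov

section Sums

theorem sum_pow_le_of_injOn {ρ : ℝ} (h0 : 0 ≤ ρ) (h1 : ρ < 1) {ι : Type*} (S : Finset ι)
    (e : ι → ℕ) (he : Set.InjOn e S) : ∑ i ∈ S, ρ ^ e i ≤ 1 / (1 - ρ) := by
  classical
  rw [← Finset.sum_image (f := fun k => ρ ^ k) he, one_div, ← tsum_geometric_of_lt_one h0 h1]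
  exact (summable_geometric_of_lt_one h0 h1).sum_le_tsum _ fun _ _ => by positivity

theorem sum_pow_dist_le {ρ : ℝ} (h0 : 0 ≤ ρ) (h1 : ρ < 1) (S : Finset ℕ) (i : ℕ) :
    ∑ j ∈ S, ρ ^ (max i j - min i j) ≤ 2 / (1 - ρ) := by
  have h2 : ∀ j ∈ S, ρ ^ (max i j - min i j)
      = (if j ≤ i then ρ ^ (i - j) else 0) + (if i < j then ρ ^ (j - i) else 0) := by
    intro j _
    rcases le_or_gt j i with h | h
    · rw [if_pos h, if_neg (by omega)]
      rw [max_eq_left h, min_eq_right h, add_zero]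
    · rw [if_neg (by omega), if_pos h]
      rw [max_eq_right (by omega), min_eq_left (by omega), zero_add]
  have h3 : ∑ j ∈ S, (if j ≤ i then ρ ^ (i - j) else 0) ≤ 1 / (1 - ρ) := by
    rw [← Finset.sum_filter]
    refine sum_pow_le_of_injOn h0 h1 _ _ fun x hx y hy hxy => ?_
    simp only [Finset.coe_filter, Set.mem_ofPred_eq] at hx hy hxy
    omega
  have h4 : ∑ j ∈ S, (if i < j then ρ ^ (j - i) else 0) ≤ 1 / (1 - ρ) := by
    rw [← Finset.sum_filter]
    refine sum_pow_le_of_injOn h0 h1 _ _ fun x hx y hy hxy => ?_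
    simp only [Finset.coe_filter, Set.mem_ofPred_eq] at hx hy hxy
    omega
  rw [Finset.sum_congr rfl h2, Finset.sum_add_distrib]
  calc _ ≤ 1 / (1 - ρ) + 1 / (1 - ρ) := add_le_add h3 h4
    _ = 2 / (1 - ρ) := by ring

theorem sum_sum_pow_dist_le {ρ : ℝ} (h0 : 0 ≤ ρ) (h1 : ρ < 1) (S : Finset ℕ) :
    ∑ i ∈ S, ∑ j ∈ S, ρ ^ (max i j - min i j) ≤ 2 / (1 - ρ) * S.card := by
  refine (Finset.sum_le_card_nsmul S _ _ fun i _ => sum_pow_dist_le h0 h1 S i).trans_eq ?_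
  rw [nsmul_eq_mul, mul_comm]

/-- Expansion of a weighted second moment into covariances. -/
theorem integral_mul_sq_sum_le {Ω : Type*} [MeasurableSpace Ω] {μ : Measure Ω} (S : Finset ℕ)
    (A : Ω → ℝ) (Z : ℕ → Ω → ℝ) (B : ℕ → ℕ → ℝ)
    (hint : ∀ i ∈ S, ∀ j ∈ S, Integrable (fun ω => Z i ω * Z j ω * A ω) μ)
    (hB : ∀ i ∈ S, ∀ j ∈ S, i ≤ j → |∫ ω, Z i ω * Z j ω * A ω ∂μ| ≤ B i j) :
    ∫ ω, A ω * (∑ i ∈ S, Z i ω) ^ 2 ∂μ ≤ ∑ i ∈ S, ∑ j ∈ S, B (min i j) (max i j) := by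
  have e : ∀ ω, A ω * (∑ i ∈ S, Z i ω) ^ 2 = ∑ i ∈ S, ∑ j ∈ S, Z i ω * Z j ω * A ω := by
    intro ω
    simp_rw [sq, Finset.sum_mul_sum, Finset.mul_sum]
    exact Finset.sum_congr rfl fun i _ => Finset.sum_congr rfl fun j _ => by ring
  simp_rw [e]
  rw [integral_finsetSum _ fun i hi => integrable_finsetSum _ fun j hj => hint i hi j hj]
  refine Finset.sum_le_sum fun i hi => ?_
  rw [integral_finsetSum _ fun j hj => hint i hi j hj]
  refine Finset.sum_le_sum fun j hj => ?_
  rcases le_total i j with h | h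
  · rw [min_eq_left h, max_eq_right h]
    exact (le_abs_self _).trans (hB i hi j hj h)
  · rw [min_eq_right h, max_eq_left h]
    simp_rw [mul_comm (Z i _) (Z j _)]
    exact (le_abs_self _).trans (hB j hj i hi h)

end Sums

/-! ### Second moments of additive functionals and of linear forms -/

/-- A Markov chain that mixes geometrically in the norms of `U` and `U ^ 2`, with `U (ξ n)` bounded
in `L⁴`. This is what geometric ergodicity with weight `V` provides for `U = V ^ (1 / 4)`. -/
structure MixingChain {Ω X : Type*} [mΩ : MeasurableSpace Ω] [MeasurableSpace X]
    (μ : Measure Ω) (ℱ : Filtration ℕ mΩ) (P : Kernel X X) (π : Measure X) (ξ : ℕ → Ω → X)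
    (U : X → ℝ) (C ρ M : ℝ) : Prop where
  chain : IsMarkovChain μ ℱ P ξ
  rate : GeometricRate P π U C ρ
  rate_sq : GeometricRate P π (fun x => U x ^ 2) C ρ
  memLp : ∀ n, MemLp (fun ω => U (ξ n ω)) 4 μ
  moment : ∀ n, ∫ ω, U (ξ n ω) ^ 4 ∂μ ≤ M

theorem holderTriple_four : ENNReal.HolderTriple 4 4 2 where
  inv_add_inv_eq_inv := by
    rw [← two_mul, show (4 : ℝ≥0∞) = 2 * 2 by norm_num,
      ENNReal.mul_inv (Or.inl (by norm_num)) (Or.inl (by norm_num)), ← mul_assoc,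
      ENNReal.mul_inv_cancel (by norm_num) (by norm_num), one_mul]

theorem memLp_two_mul {Ω : Type*} [MeasurableSpace Ω] {μ : Measure Ω} {f g : Ω → ℝ}
    (hf : MemLp f 4 μ) (hg : MemLp g 4 μ) : MemLp (fun ω => f ω * g ω) 2 μ :=
  haveI := holderTriple_four
  hg.mul hf

theorem integrable_mul_of_memLp_two {Ω : Type*} [MeasurableSpace Ω] {μ : Measure Ω}
    {f g : Ω → ℝ} (hf : MemLp f 2 μ) (hg : MemLp g 2 μ) : Integrable (fun ω => f ω * g ω) μ :=
  hf.integrable_mul hg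

section Moments

variable {Ω X : Type*} [mΩ : MeasurableSpace Ω] [MeasurableSpace X]
  {μ : Measure Ω} {ℱ : Filtration ℕ mΩ} {P : Kernel X X}
  {π : Measure X} {ξ : ℕ → Ω → X} {U : X → ℝ} {C ρ M : ℝ}

namespace MixingChain

theorem integrable_pow_four (H : MixingChain μ ℱ P π ξ U C ρ M) (n : ℕ) :
    Integrable (fun ω => U (ξ n ω) ^ 4) μ := by
  refine (integrable_mul_of_memLp_two (memLp_two_mul (H.memLp n) (H.memLp n))
    (memLp_two_mul (H.memLp n) (H.memLp n))).congr (ae_of_all _ fun ω => ?_)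
  ring

theorem moment_nonneg (H : MixingChain μ ℱ P π ξ U C ρ M) : 0 ≤ M :=
  (integral_nonneg fun ω => by positivity).trans (H.moment 0)

theorem integral_abs_le (H : MixingChain μ ℱ P π ξ U C ρ M) {F : Ω → ℝ} {a : ℝ} (ha : 0 ≤ a)
    (i j k l : ℕ)
    (hF : ∀ ω, |F ω| ≤ a * (U (ξ i ω) * U (ξ j ω) * U (ξ k ω) * U (ξ l ω))) :
    ∫ ω, |F ω| ∂μ ≤ a * M := by
  have hi := fun n => H.integrable_pow_four n
  have h1 : ∀ ω, |F ω| ≤ a * ((U (ξ i ω) ^ 4 + U (ξ j ω) ^ 4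
      + (U (ξ k ω) ^ 4 + U (ξ l ω) ^ 4)) / 4) := by
    intro ω
    refine (hF ω).trans (mul_le_mul_of_nonneg_left ?_ ha)
    generalize U (ξ i ω) = x
    generalize U (ξ j ω) = y
    generalize U (ξ k ω) = z
    generalize U (ξ l ω) = t
    nlinarith [sq_nonneg (x * y - z * t), sq_nonneg (x ^ 2 - y ^ 2), sq_nonneg (z ^ 2 - t ^ 2)]
  have hint := ((((hi i).add (hi j)).add ((hi k).add (hi l))).div_const 4).const_mul a
  calc ∫ ω, |F ω| ∂μ ≤ ∫ ω, a * ((U (ξ i ω) ^ 4 + U (ξ j ω) ^ 4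
      + (U (ξ k ω) ^ 4 + U (ξ l ω) ^ 4)) / 4) ∂μ :=
        integral_mono_of_nonneg (ae_of_all _ fun ω => abs_nonneg _) hint (ae_of_all _ h1)
    _ = a * ((∫ ω, U (ξ i ω) ^ 4 ∂μ + ∫ ω, U (ξ j ω) ^ 4 ∂μ
      + (∫ ω, U (ξ k ω) ^ 4 ∂μ + ∫ ω, U (ξ l ω) ^ 4 ∂μ)) / 4) := by
        rw [integral_const_mul, integral_div, integral_add, integral_add (hi i) (hi j),
          integral_add (hi k) (hi l)]
        · exact (hi i).add (hi j)
        · exact (hi k).add (hi l)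
    _ ≤ a * M := by
        have h1 := H.moment i
        have h2 := H.moment j
        have h3 := H.moment k
        have h4 := H.moment l
        refine mul_le_mul_of_nonneg_left ?_ ha
        linarith

theorem memLp_comp (H : MixingChain μ ℱ P π ξ U C ρ M) {f : X → ℝ} {a : ℝ} (hf : Measurable f)
    (hfa : ∀ x, |f x| ≤ a * U x) (n : ℕ) : MemLp (fun ω => f (ξ n ω)) 4 μ :=
  ((H.memLp n).const_mul a).mono' (hf.comp (H.chain.measurable n)).aestronglyMeasurable
    (ae_of_all _ fun _ => hfa _)

theorem memLp_comp_sq (H : MixingChain μ ℱ P π ξ U C ρ M) {f : X → ℝ} {a : ℝ}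
    (hf : Measurable f) (hfa : ∀ x, |f x| ≤ a * U x ^ 2) (n : ℕ) :
    MemLp (fun ω => f (ξ n ω)) 2 μ :=
  ((memLp_two_mul (H.memLp n) (H.memLp n)).const_mul a).mono'
    (hf.comp (H.chain.measurable n)).aestronglyMeasurable
    (ae_of_all _ fun ω => by simpa [sq] using hfa (ξ n ω))

theorem memLp_sq (H : MixingChain μ ℱ P π ξ U C ρ M) (n : ℕ) :
    MemLp (fun ω => U (ξ n ω) ^ 2) 2 μ :=
  H.memLp_comp_sq (f := fun x => U x ^ 2) (a := 1) (H.rate.measurable.pow_const 2)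
    (fun x => by rw [one_mul, abs_of_nonneg (sq_nonneg _)]) n

variable [IsProbabilityMeasure μ]

/-- Square-integrable additive functionals with centred summands have variance linear in the
number of summands. -/
theorem integral_sq_sum_comp_le (H : MixingChain μ ℱ P π ξ U C ρ M) {Φ : ℕ → X → ℝ} {a : ℝ}
    (ha : 0 ≤ a) (hΦ : ∀ i, Measurable (Φ i)) (hΦa : ∀ i x, |Φ i x| ≤ a * U x ^ 2)
    (hΦπ : ∀ i, ∫ x, Φ i x ∂π = 0) (S : Finset ℕ) :
    ∫ ω, (∑ i ∈ S, Φ i (ξ i ω)) ^ 2 ∂μ ≤ a * C * (a * M) * (2 / (1 - ρ)) * S.card := by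
  have hL := fun i => H.memLp_comp_sq (hΦ i) (hΦa i) i
  have h1 := integral_mul_sq_sum_le (μ := μ) S (fun _ => 1) (fun i ω => Φ i (ξ i ω))
    (fun i j => a * C * (a * M) * ρ ^ (j - i))
    (fun i _ j _ => by
      simp only [mul_one]
      exact integrable_mul_of_memLp_two (hL i) (hL j))
    (fun i _ j _ hij => by
      obtain ⟨k, rfl⟩ := Nat.exists_eq_add_of_le hij
      simp only [mul_one, Nat.add_sub_cancel_left]
      have h2 := H.chain.abs_integral_mul_sub_le H.rate_sq
        (fun m => (H.memLp_sq m).integrable one_le_two)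
        (G := fun ω => Φ i (ξ i ω)) (n := i) (H.chain.stronglyMeasurable_comp (hΦ i) le_rfl)
        ((hL i).integrable one_le_two) (fun m => integrable_mul_of_memLp_two (hL i) (H.memLp_sq m))
        k (hΦ (i + k)) (hΦa (i + k))
      rw [hΦπ, zero_mul, sub_zero] at h2
      refine h2.trans ?_
      have h3 : ∫ ω, |Φ i (ξ i ω)| * U (ξ i ω) ^ 2 ∂μ ≤ a * M := by
        refine (le_of_eq ?_).trans (H.integral_abs_le
          (F := fun ω => Φ i (ξ i ω) * U (ξ i ω) ^ 2) ha i i i i fun ω => ?_)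
        · simp_rw [abs_mul, abs_of_nonneg (sq_nonneg (U _))]
        · rw [abs_mul, abs_of_nonneg (sq_nonneg (U _))]
          calc |Φ i (ξ i ω)| * U (ξ i ω) ^ 2 ≤ (a * U (ξ i ω) ^ 2) * U (ξ i ω) ^ 2 := by
                gcongr; exact hΦa i _
            _ = _ := by ring
      have hC := H.rate.C_nonneg
      have hρ := H.rate.rho_pos
      calc _ ≤ a * C * ρ ^ k * (a * M) := by gcongr
        _ = _ := by ring)
  simp only [one_mul] at h1
  refine h1.trans ?_
  simp_rw [← Finset.mul_sum]
  have h4 := sum_sum_pow_dist_le H.rate.rho_pos.le H.rate.rho_lt_one S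
  have hC := H.rate.C_nonneg
  have hM := H.moment_nonneg
  calc _ ≤ a * C * (a * M) * (2 / (1 - ρ) * S.card) := by gcongr
    _ = _ := by ring

/-- A weighted sum of the `h (ξ i)` has second moment linear in the number of summands, and this
persists with the weight `U (ξ p) ^ 2` at a later time `p`. The expectation of a product of two
summands and this weight decays both in the gap between the summands and in the gap between the
second one and `p`. -/
theorem exists_integral_sq_mul_sq_sum_le (H : MixingChain μ ℱ P π ξ U C ρ M) {h : X → ℝ} {b : ℝ}
    (hb : 0 ≤ b) (hh : Measurable h) (hhb : ∀ x, |h x| ≤ b * U x) (hπ : ∫ x, h x ∂π = 0) :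
    ∃ K, 0 ≤ K ∧ ∀ (S : Finset ℕ) (p : ℕ) (u : ℕ → ℝ), (∀ i ∈ S, i ≤ p) →
      (∀ i ∈ S, |u i| ≤ 1) →
      ∫ ω, U (ξ p ω) ^ 2 * (∑ i ∈ S, u i * h (ξ i ω)) ^ 2 ∂μ ≤ K * S.card := by
  have hC := H.rate.C_nonneg
  have hM := H.moment_nonneg
  have hρ := H.rate.rho_pos
  have hρ1 : 0 < 1 - ρ := sub_pos.2 H.rate.rho_lt_one
  have hU2 := H.rate_sq.integral_nonneg
  set q := ∫ x, U x ^ 2 ∂π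
  have hL := fun i => H.memLp_comp hh hhb i
  have hLL := fun i j => memLp_two_mul (hL i) (hL j)
  -- Covariances of the summands themselves.
  have hcov : ∀ i k, |∫ ω, h (ξ i ω) * h (ξ (i + k) ω) ∂μ| ≤ b ^ 2 * C * M * ρ ^ k := by
    intro i k
    have h2 := H.chain.abs_integral_mul_sub_le H.rate
      (fun m => (H.memLp m).integrable (by norm_num))
      (G := fun ω => h (ξ i ω)) (n := i) (H.chain.stronglyMeasurable_comp hh le_rfl)
      ((hL i).integrable (by norm_num))
      (fun m => (memLp_two_mul (hL i) (H.memLp m)).integrable one_le_two) k hh hhb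
    rw [hπ, zero_mul, sub_zero] at h2
    refine h2.trans ?_
    have h3 : ∫ ω, |h (ξ i ω)| * U (ξ i ω) ∂μ ≤ b * M := by
      refine (le_of_eq ?_).trans (H.integral_abs_le
        (F := fun ω => h (ξ i ω) * U (ξ i ω)) hb i i i i fun ω => ?_)
      · simp_rw [abs_mul, abs_of_nonneg (H.rate.nonneg _)]
      · rw [abs_mul, abs_of_nonneg (H.rate.nonneg _)]
        have h1 := H.rate.one_le (ξ i ω)
        have h0 := H.rate.nonneg (ξ i ω)
        calc |h (ξ i ω)| * U (ξ i ω) ≤ (b * U (ξ i ω)) * U (ξ i ω) := by gcongr; exact hhb _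
          _ = b * (U (ξ i ω) * U (ξ i ω) * 1 * 1) := by ring
          _ ≤ _ := by gcongr
    calc _ ≤ b * C * ρ ^ k * (b * M) := by gcongr
      _ = _ := by ring
  -- Covariances in the presence of the weight at time `p`.
  have hcov2 : ∀ i j p, i ≤ j → j ≤ p → |∫ ω, h (ξ i ω) * h (ξ j ω) * U (ξ p ω) ^ 2 ∂μ|
      ≤ b ^ 2 * C * M * (q + 1) * (ρ ^ (j - i) + ρ ^ (p - j)) := by
    intro i j p hij hjp
    obtain ⟨k, rfl⟩ := Nat.exists_eq_add_of_le hij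
    obtain ⟨l, rfl⟩ := Nat.exists_eq_add_of_le hjp
    have h2 := H.chain.abs_integral_mul_sub_le H.rate_sq
      (fun m => (H.memLp_sq m).integrable one_le_two)
      (G := fun ω => h (ξ i ω) * h (ξ (i + k) ω)) (n := i + k)
      ((H.chain.stronglyMeasurable_comp hh hij).mul (H.chain.stronglyMeasurable_comp hh le_rfl))
      ((hLL _ _).integrable one_le_two)
      (fun m => integrable_mul_of_memLp_two (hLL _ _) (H.memLp_sq m)) l
      (a := 1) (H.rate.measurable.pow_const 2)
      (fun x => by rw [one_mul, abs_of_nonneg (sq_nonneg _)])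
    have h3 : ∫ ω, |h (ξ i ω) * h (ξ (i + k) ω)| * U (ξ (i + k) ω) ^ 2 ∂μ ≤ b ^ 2 * M := by
      refine (le_of_eq ?_).trans (H.integral_abs_le
        (F := fun ω => h (ξ i ω) * h (ξ (i + k) ω) * U (ξ (i + k) ω) ^ 2) (sq_nonneg b)
          i (i + k) (i + k) (i + k) fun ω => ?_)
      · simp_rw [abs_mul, abs_of_nonneg (sq_nonneg (U _))]
      · rw [abs_mul, abs_mul, abs_of_nonneg (sq_nonneg (U _))]
        have h0 := H.rate.nonneg (ξ i ω)
        calc _ ≤ (b * U (ξ i ω)) * (b * U (ξ (i + k) ω)) * U (ξ (i + k) ω) ^ 2 := by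
              gcongr <;> exact hhb _
          _ = _ := by ring
    have h4 := hcov i k
    have h5 := abs_sub_abs_le_abs_sub
      (∫ ω, h (ξ i ω) * h (ξ (i + k) ω) * U (ξ (i + k + l) ω) ^ 2 ∂μ)
      (q * ∫ ω, h (ξ i ω) * h (ξ (i + k) ω) ∂μ)
    rw [abs_mul, abs_of_nonneg hU2] at h5
    simp only [Nat.add_sub_cancel_left]
    have h6 : q * |∫ ω, h (ξ i ω) * h (ξ (i + k) ω) ∂μ| ≤ q * (b ^ 2 * C * M * ρ ^ k) := by
      gcongr
    have h7 : 1 * C * ρ ^ l * ∫ ω, |h (ξ i ω) * h (ξ (i + k) ω)| * U (ξ (i + k) ω) ^ 2 ∂μ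
        ≤ 1 * C * ρ ^ l * (b ^ 2 * M) := by gcongr
    have h8 : 0 ≤ b ^ 2 * C * M * ρ ^ k := by positivity
    have h9 : 0 ≤ q * (b ^ 2 * C * M * ρ ^ l) := by positivity
    linarith
  refine ⟨b ^ 2 * C * M * (q + 1) * (4 / (1 - ρ)), by positivity, fun S p u hS hu => ?_⟩
  have h1 := integral_mul_sq_sum_le (μ := μ) S (fun ω => U (ξ p ω) ^ 2)
    (fun i ω => u i * h (ξ i ω))
    (fun i j => b ^ 2 * C * M * (q + 1) * (ρ ^ (j - i) + (ρ ^ (p - i) + ρ ^ (p - j))))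
    (fun i _ j _ => by
      refine ((integrable_mul_of_memLp_two (hLL i j) (H.memLp_sq p)).const_mul
        (u i * u j)).congr (ae_of_all _ fun ω => ?_)
      ring)
    (fun i hi j hj hij => by
      have e : ∀ ω, u i * h (ξ i ω) * (u j * h (ξ j ω)) * U (ξ p ω) ^ 2
          = (u i * u j) * (h (ξ i ω) * h (ξ j ω) * U (ξ p ω) ^ 2) := fun ω => by ring
      simp_rw [e]
      rw [integral_const_mul, abs_mul, abs_mul]
      have h2 : |u i| * |u j| ≤ 1 := mul_le_one₀ (hu i hi) (abs_nonneg _) (hu j hj)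
      refine (mul_le_of_le_one_left (abs_nonneg _) h2).trans
        ((hcov2 i j p hij (hS j hj)).trans ?_)
      gcongr
      exact le_add_of_nonneg_left (by positivity))
  refine h1.trans ?_
  have e : ∀ i j, ρ ^ (p - min i j) + ρ ^ (p - max i j) = ρ ^ (p - i) + ρ ^ (p - j) := by
    intro i j
    rcases le_total i j with hij | hij
    · rw [min_eq_left hij, max_eq_right hij]
    · rw [min_eq_right hij, max_eq_left hij, add_comm]
  simp_rw [← Finset.mul_sum, e, Finset.sum_add_distrib, Finset.sum_const, ← Finset.smul_sum,
    nsmul_eq_mul]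
  have h2 := sum_sum_pow_dist_le hρ.le H.rate.rho_lt_one S
  have h3 : ∑ i ∈ S, ρ ^ (p - i) ≤ 1 / (1 - ρ) :=
    sum_pow_le_of_injOn hρ.le H.rate.rho_lt_one S _ fun x hx y hy hxy => by
      have := hS x hx
      have := hS y hy
      omega
  calc _ ≤ b ^ 2 * C * M * (q + 1) * (2 / (1 - ρ) * S.card
        + (S.card * (1 / (1 - ρ)) + S.card * (1 / (1 - ρ)))) := by gcongr
    _ = _ := by ring

end MixingChain

end Moments

/-! ### Quadratic forms: martingale decomposition and variance -/

section Decomposition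

variable {Ω X : Type*} [MeasurableSpace X]

/-- The function `P ^ s h`. -/
noncomputable def iterFun (P : Kernel X X) (h : X → ℝ) (s : ℕ) (x : X) : ℝ :=
  ∫ y, h y ∂((P ^ s) x)

/-- The increment from time `m` to time `m + 1` of the martingale that predicts `h (ξ (m + 1 + s))`,
namely `E (h (ξ (m + 1 + s)) | ℱ (m + 1)) - E (h (ξ (m + 1 + s)) | ℱ m)`. -/
noncomputable def innovation (P : Kernel X X) (h : X → ℝ) (ξ : ℕ → Ω → X) (s m : ℕ) (ω : Ω) : ℝ :=
  iterFun P h s (ξ (m + 1) ω) - iterFun P h (s + 1) (ξ m ω)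

theorem measurable_iterFun (P : Kernel X X) {h : X → ℝ} (hh : Measurable h) (s : ℕ) :
    Measurable (iterFun P h s) :=
  measurable_integral_pow P s hh

theorem iterFun_zero (P : Kernel X X) {h : X → ℝ} (hh : Measurable h) (x : X) :
    iterFun P h 0 x = h x := by
  have : (P ^ 0) x = Measure.dirac x := by rw [pow_zero]; rfl
  rw [iterFun, this, integral_dirac' _ _ hh.stronglyMeasurable]

/-- Telescoping of the prediction error of `h (ξ j)` from time `i` into innovations. -/
theorem sub_iterFun_eq_sum_innovation (P : Kernel X X) {h : X → ℝ} (hh : Measurable h)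
    (ξ : ℕ → Ω → X) {i j : ℕ} (hij : i ≤ j) (ω : Ω) :
    h (ξ j ω) - iterFun P h (j - i) (ξ i ω)
      = ∑ m ∈ Finset.Ico i j, innovation P h ξ (j - (m + 1)) m ω := by
  have e : ∀ m ∈ Finset.Ico i j, innovation P h ξ (j - (m + 1)) m ω
      = iterFun P h (j - (m + 1)) (ξ (m + 1) ω) - iterFun P h (j - m) (ξ m ω) := by
    intro m hm
    rw [Finset.mem_Ico] at hm
    rw [innovation, show j - (m + 1) + 1 = j - m by omega]
  rw [Finset.sum_congr rfl e, Finset.sum_Ico_sub (fun m => iterFun P h (j - m) (ξ m ω)) hij,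
    Nat.sub_self, iterFun_zero P hh]

/-- The part of the quadratic form `∑ i ≤ j ≤ n, α i j * h (ξ i) * h (ξ j)` that is revealed in the
step from time `m` to time `m + 1`: the innovations of the `h (ξ j)`, `j > m`, are multiplied by
the linear forms `∑ i ≤ m, α i j * h (ξ i)`, which are known at time `m`. -/
noncomputable def quadIncrement (P : Kernel X X) (h : X → ℝ) (ξ : ℕ → Ω → X) (α : ℕ → ℕ → ℝ)
    (n m : ℕ) (ω : Ω) : ℝ :=
  ∑ j ∈ Finset.Icc (m + 1) n, (∑ i ∈ Finset.Icc 1 m, α i j * h (ξ i ω))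
    * innovation P h ξ (j - (m + 1)) m ω

/-- Decomposition of a centred quadratic form into an additive functional and a sum of martingale
increments. -/
theorem sum_sum_mul_sub_eq (P : Kernel X X) {h : X → ℝ} (hh : Measurable h) (ξ : ℕ → Ω → X)
    (α : ℕ → ℕ → ℝ) (γ : ℕ → ℝ) (n : ℕ) (ω : Ω) :
    ∑ j ∈ Finset.Icc 1 n, ∑ i ∈ Finset.Icc 1 j, α i j * (h (ξ i ω) * h (ξ j ω) - γ (j - i))
      = ∑ i ∈ Finset.Icc 1 n, ∑ j ∈ Finset.Icc i n,
          α i j * (h (ξ i ω) * iterFun P h (j - i) (ξ i ω) - γ (j - i))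
        + ∑ m ∈ Finset.range n, quadIncrement P h ξ α n m ω := by
  have e1 : ∀ j ∈ Finset.Icc 1 n, ∀ i ∈ Finset.Icc 1 j,
      α i j * (h (ξ i ω) * h (ξ j ω) - γ (j - i))
        = α i j * (h (ξ i ω) * iterFun P h (j - i) (ξ i ω) - γ (j - i))
          + ∑ m ∈ Finset.Ico i j, α i j * h (ξ i ω) * innovation P h ξ (j - (m + 1)) m ω := by
    intro j _ i hi
    rw [← Finset.mul_sum,
      ← sub_iterFun_eq_sum_innovation P hh ξ (Finset.mem_Icc.1 hi).2]
    ring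
  rw [Finset.sum_congr rfl fun j hj => Finset.sum_congr rfl (e1 j hj)]
  simp_rw [Finset.sum_add_distrib]
  congr 1
  · refine Finset.sum_comm' fun i j => ?_
    simp only [Finset.mem_Icc]
    omega
  · have e2 : ∀ j ∈ Finset.Icc 1 n, ∑ i ∈ Finset.Icc 1 j, ∑ m ∈ Finset.Ico i j,
        α i j * h (ξ i ω) * innovation P h ξ (j - (m + 1)) m ω
        = ∑ m ∈ Finset.range j, ∑ i ∈ Finset.Icc 1 m,
        α i j * h (ξ i ω) * innovation P h ξ (j - (m + 1)) m ω := by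
      intro j _
      refine Finset.sum_comm' fun i m => ?_
      simp only [Finset.mem_Icc, Finset.mem_Ico, Finset.mem_range]
      omega
    rw [Finset.sum_congr rfl e2]
    simp_rw [quadIncrement, Finset.sum_mul]
    refine Finset.sum_comm' fun j m => ?_
    simp only [Finset.mem_Icc, Finset.mem_range]
    omega

end Decomposition

section Quadratic

variable {Ω X : Type*} [mΩ : MeasurableSpace Ω] [MeasurableSpace X]
  {μ : Measure Ω} {ℱ : Filtration ℕ mΩ} {P : Kernel X X}
  {π : Measure X} {ξ : ℕ → Ω → X} {U : X → ℝ} {C ρ M : ℝ}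

theorem GeometricRate.abs_iterFun_le (hR : GeometricRate P π U C ρ) {h : X → ℝ} {b : ℝ}
    (hh : Measurable h) (hhb : ∀ x, |h x| ≤ b * U x) (hπ : ∫ x, h x ∂π = 0) (s : ℕ) (x : X) :
    |iterFun P h s x| ≤ b * C * ρ ^ s * U x := by
  have := hR.rate h b hh hhb s x
  rwa [hπ, sub_zero] at this

namespace MixingChain

theorem memLp_innovation (H : MixingChain μ ℱ P π ξ U C ρ M) {h : X → ℝ} {b : ℝ}
    (hh : Measurable h) (hhb : ∀ x, |h x| ≤ b * U x) (hπ : ∫ x, h x ∂π = 0) (s m : ℕ) :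
    MemLp (innovation P h ξ s m) 4 μ :=
  (H.memLp_comp (measurable_iterFun P hh s) (H.rate.abs_iterFun_le hh hhb hπ s) (m + 1)).sub
    (H.memLp_comp (measurable_iterFun P hh _) (H.rate.abs_iterFun_le hh hhb hπ (s + 1)) m)

theorem memLp_linear (H : MixingChain μ ℱ P π ξ U C ρ M) {h : X → ℝ} {b : ℝ}
    (hh : Measurable h) (hhb : ∀ x, |h x| ≤ b * U x) (S : Finset ℕ) (u : ℕ → ℝ) :
    MemLp (fun ω => ∑ i ∈ S, u i * h (ξ i ω)) 4 μ :=
  memLp_finsetSum _ fun i _ => (H.memLp_comp hh hhb i).const_mul _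

theorem memLp_quadIncrement (H : MixingChain μ ℱ P π ξ U C ρ M) {h : X → ℝ} {b : ℝ}
    (hh : Measurable h) (hhb : ∀ x, |h x| ≤ b * U x) (hπ : ∫ x, h x ∂π = 0) (α : ℕ → ℕ → ℝ)
    (n m : ℕ) : MemLp (quadIncrement P h ξ α n m) 2 μ :=
  memLp_finsetSum _ fun _ _ => memLp_two_mul (H.memLp_linear hh hhb _ _)
    (H.memLp_innovation hh hhb hπ _ _)

theorem stronglyMeasurable_innovation (H : MixingChain μ ℱ P π ξ U C ρ M) {h : X → ℝ}
    (hh : Measurable h) (s : ℕ) {m k : ℕ} (hmk : m + 1 ≤ k) :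
    StronglyMeasurable[ℱ k] (innovation P h ξ s m) :=
  (H.chain.stronglyMeasurable_comp (measurable_iterFun P hh s) hmk).sub
    (H.chain.stronglyMeasurable_comp (measurable_iterFun P hh _) (by omega))

theorem stronglyMeasurable_linear (H : MixingChain μ ℱ P π ξ U C ρ M) {h : X → ℝ}
    (hh : Measurable h) {S : Finset ℕ} {k : ℕ} (hS : ∀ i ∈ S, i ≤ k) (u : ℕ → ℝ) :
    StronglyMeasurable[ℱ k] fun ω => ∑ i ∈ S, u i * h (ξ i ω) :=
  Finset.stronglyMeasurable_fun_sum _ fun i hi =>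
    (H.chain.stronglyMeasurable_comp hh (hS i hi)).const_mul _

theorem stronglyMeasurable_quadIncrement (H : MixingChain μ ℱ P π ξ U C ρ M) {h : X → ℝ}
    (hh : Measurable h) (α : ℕ → ℕ → ℝ) (n : ℕ) {m k : ℕ} (hmk : m + 1 ≤ k) :
    StronglyMeasurable[ℱ k] (quadIncrement P h ξ α n m) :=
  Finset.stronglyMeasurable_fun_sum _ fun _ _ =>
    (H.stronglyMeasurable_linear hh (fun i hi => by
      have := (Finset.mem_Icc.1 hi).2
      omega) _).mul (H.stronglyMeasurable_innovation hh _ hmk)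

theorem abs_autocov_le (H : MixingChain μ ℱ P π ξ U C ρ M) {h : X → ℝ}
    {b : ℝ} (hh : Measurable h) (hhb : ∀ x, |h x| ≤ b * U x)
    (hπ : ∫ x, h x ∂π = 0) (l : ℕ) :
    |autocov P π h l| ≤ b ^ 2 * C * (∫ x, U x ^ 2 ∂π) * ρ ^ l := by
  have h1 := H.rate_sq.abs_integral_le (f := fun x => h x * iterFun P h l x)
    (a := b ^ 2 * C * ρ ^ l) fun x => by
      rw [abs_mul]
      have := H.rate.abs_iterFun_le hh hhb hπ l x
      calc _ ≤ (b * U x) * (b * C * ρ ^ l * U x) :=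
            mul_le_mul (hhb x) this (abs_nonneg _) ((abs_nonneg _).trans (hhb x))
        _ = _ := by ring
  simp only [autocov, hπ, sub_zero]
  refine h1.trans_eq ?_
  ring

theorem memLp_mul_sub [IsFiniteMeasure μ] (H : MixingChain μ ℱ P π ξ U C ρ M) {h : X → ℝ} {b : ℝ}
    (hh : Measurable h) (hhb : ∀ x, |h x| ≤ b * U x) (i j : ℕ) (c : ℝ) :
    MemLp (fun ω => h (ξ i ω) * h (ξ j ω) - c) 2 μ :=
  (memLp_two_mul (H.memLp_comp hh hhb i) (H.memLp_comp hh hhb j)).sub (memLp_const c)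

variable [IsProbabilityMeasure μ]

/-- Innovations are orthogonal to the past. -/
theorem integral_mul_innovation (H : MixingChain μ ℱ P π ξ U C ρ M) {h : X → ℝ} {b : ℝ}
    (hh : Measurable h) (hhb : ∀ x, |h x| ≤ b * U x) (hπ : ∫ x, h x ∂π = 0) (s m : ℕ)
    {G : Ω → ℝ} (hG : StronglyMeasurable[ℱ m] G)
    (hGU : ∀ k, Integrable (fun ω => G ω * U (ξ k ω)) μ) :
    ∫ ω, G ω * innovation P h ξ s m ω ∂μ = 0 := by
  have hg := H.rate.abs_iterFun_le hh hhb hπ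
  have hgm := measurable_iterFun P hh
  have h1 := H.chain.integral_mul_succ H.rate (fun m => (H.memLp m).integrable (by norm_num))
    hG hGU (hgm s) (hg s)
  have e : ∀ x, ∫ z, iterFun P h s z ∂(P x) = iterFun P h (s + 1) x := fun x =>
    (H.rate.integral_pow_succ' hh hhb s x).symm
  have hGm := (hG.mono (ℱ.le m)).aestronglyMeasurable (μ := μ)
  simp_rw [innovation, mul_sub]
  rw [integral_sub, h1]
  · simp_rw [e, sub_self]
  · exact integrable_mul_of_le H.rate (H.chain.measurable _) hGm (hGU _) (hgm s) (hg s)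
  · exact integrable_mul_of_le H.rate (H.chain.measurable _) hGm (hGU _) (hgm _) (hg _)

theorem integral_mul_quadIncrement (H : MixingChain μ ℱ P π ξ U C ρ M) {h : X → ℝ} {b : ℝ}
    (hh : Measurable h) (hhb : ∀ x, |h x| ≤ b * U x) (hπ : ∫ x, h x ∂π = 0) (α : ℕ → ℕ → ℝ)
    (n m : ℕ) {G : Ω → ℝ} (hG : StronglyMeasurable[ℱ m] G) (hG2 : MemLp G 2 μ) :
    ∫ ω, G ω * quadIncrement P h ξ α n m ω ∂μ = 0 := by
  simp_rw [quadIncrement, Finset.mul_sum]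
  rw [integral_finsetSum]
  · refine Finset.sum_eq_zero fun j _ => ?_
    simp_rw [← mul_assoc]
    refine H.integral_mul_innovation hh hhb hπ _ m
      (hG.mul (H.stronglyMeasurable_linear hh (fun i hi => (Finset.mem_Icc.1 hi).2) _))
      fun k => ?_
    simp_rw [mul_assoc]
    exact integrable_mul_of_memLp_two hG2 (memLp_two_mul (H.memLp_linear hh hhb _ _) (H.memLp k))
  · exact fun j _ => integrable_mul_of_memLp_two hG2
      (memLp_two_mul (H.memLp_linear hh hhb _ _) (H.memLp_innovation hh hhb hπ _ _))

theorem integral_sq_sum_quadIncrement (H : MixingChain μ ℱ P π ξ U C ρ M) {h : X → ℝ} {b : ℝ}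
    (hh : Measurable h) (hhb : ∀ x, |h x| ≤ b * U x) (hπ : ∫ x, h x ∂π = 0) (α : ℕ → ℕ → ℝ)
    (n k : ℕ) :
    ∫ ω, (∑ m ∈ Finset.range k, quadIncrement P h ξ α n m ω) ^ 2 ∂μ
      = ∑ m ∈ Finset.range k, ∫ ω, quadIncrement P h ξ α n m ω ^ 2 ∂μ := by
  induction k with
  | zero => simp
  | succ k ih =>
    have hL := H.memLp_quadIncrement hh hhb hπ α n
    have hS : MemLp (fun ω => ∑ m ∈ Finset.range k, quadIncrement P h ξ α n m ω) 2 μ :=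
      memLp_finsetSum _ fun m _ => hL m
    have hSm : StronglyMeasurable[ℱ k]
        fun ω => ∑ m ∈ Finset.range k, quadIncrement P h ξ α n m ω :=
      Finset.stronglyMeasurable_fun_sum _ fun m hm =>
        H.stronglyMeasurable_quadIncrement hh α n (Finset.mem_range.1 hm)
    have h0 := H.integral_mul_quadIncrement hh hhb hπ α n k hSm hS
    have hi := integrable_mul_of_memLp_two hS (hL k)
    simp_rw [Finset.sum_range_succ, add_sq, mul_assoc]
    rw [integral_add, integral_add, integral_const_mul, h0, ih]
    · simp
    · exact hS.integrable_sq
    · exact hi.const_mul 2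
    · exact hS.integrable_sq.add (hi.const_mul 2)
    · exact (hL k).integrable_sq

/-- A martingale increment of the quadratic form has second moment of the order of the number of
nonzero coefficients per column, because the innovations decay geometrically. -/
theorem exists_integral_sq_quadIncrement_le (H : MixingChain μ ℱ P π ξ U C ρ M) {h : X → ℝ}
    {b : ℝ} (hb : 0 ≤ b) (hh : Measurable h) (hhb : ∀ x, |h x| ≤ b * U x)
    (hπ : ∫ x, h x ∂π = 0) :
    ∃ K, 0 ≤ K ∧ ∀ (n m N : ℕ) (α : ℕ → ℕ → ℝ), (∀ i j, |α i j| ≤ 1) →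
      (∀ j ∈ Finset.Icc (m + 1) n,
        ((Finset.Icc 1 m).filter fun i => α i j ≠ 0).card ≤ N) →
      ∫ ω, quadIncrement P h ξ α n m ω ^ 2 ∂μ ≤ K * N := by
  obtain ⟨K, hK, hKb⟩ := H.exists_integral_sq_mul_sq_sum_le hb hh hhb hπ
  have hC := H.rate.C_nonneg
  have hρ := H.rate.rho_pos
  have hρl := H.rate.rho_lt_one
  have hρ1 : 0 < 1 - ρ := sub_pos.2 hρl
  refine ⟨1 / (1 - ρ) * (2 * (b * C) ^ 2 * (2 * K) * (1 / (1 - ρ))), by positivity,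
    fun n m N α hα hN => ?_⟩
  set T : ℕ → Ω → ℝ := fun j ω => ∑ i ∈ Finset.Icc 1 m, α i j * h (ξ i ω) with hT
  set w : ℕ → Ω → ℝ := fun j ω => U (ξ (m + 1) ω) ^ 2 * T j ω ^ 2 + U (ξ m ω) ^ 2 * T j ω ^ 2
    with hw
  have hTw : ∀ p, m ≤ p → ∀ j ∈ Finset.Icc (m + 1) n,
      Integrable (fun ω => U (ξ p ω) ^ 2 * T j ω ^ 2) μ ∧
      ∫ ω, U (ξ p ω) ^ 2 * T j ω ^ 2 ∂μ ≤ K * N := by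
    intro p hp j hj
    constructor
    · have hTL := H.memLp_linear hh hhb (Finset.Icc 1 m) fun i => α i j
      refine (integrable_mul_of_memLp_two (H.memLp_sq p) (memLp_two_mul hTL hTL)).congr
        (ae_of_all _ fun ω => ?_)
      simp only [hT, sq]
    · have e : ∀ ω, T j ω
          = ∑ i ∈ (Finset.Icc 1 m).filter fun i => α i j ≠ 0, α i j * h (ξ i ω) := by
        intro ω
        refine (Finset.sum_filter_of_ne fun i _ hi => ?_).symm
        exact left_ne_zero_of_mul hi
      simp_rw [e]
      refine (hKb _ p (fun i => α i j) (fun i hi => ?_) fun i _ => hα i j).trans ?_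
      · simp only [Finset.mem_filter, Finset.mem_Icc] at hi
        omega
      · gcongr
        exact hN j hj
  have hwi : ∀ j ∈ Finset.Icc (m + 1) n, Integrable (w j) μ := fun j hj =>
    (hTw (m + 1) (by omega) j hj).1.add (hTw m le_rfl j hj).1
  have hwb : ∀ j ∈ Finset.Icc (m + 1) n, ∫ ω, w j ω ∂μ ≤ 2 * K * N := by
    intro j hj
    rw [hw]
    simp only
    rw [integral_add (hTw (m + 1) (by omega) j hj).1 (hTw m le_rfl j hj).1]
    have := (hTw (m + 1) (by omega) j hj).2
    have := (hTw m le_rfl j hj).2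
    linarith
  have hgeom : ∑ j ∈ Finset.Icc (m + 1) n, ρ ^ (j - (m + 1)) ≤ 1 / (1 - ρ) :=
    sum_pow_le_of_injOn hρ.le hρl _ _ fun x hx y hy hxy => by
      simp only [Finset.coe_Icc, Set.mem_Icc] at hx hy
      omega
  have hD : ∀ s ω, innovation P h ξ s m ω ^ 2
      ≤ 2 * (b * C) ^ 2 * ρ ^ s * ρ ^ s * (U (ξ (m + 1) ω) ^ 2 + U (ξ m ω) ^ 2) := by
    intro s ω
    have h1 := H.rate.abs_iterFun_le hh hhb hπ s (ξ (m + 1) ω)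
    have h2 : |iterFun P h (s + 1) (ξ m ω)| ≤ b * C * ρ ^ s * U (ξ m ω) := by
      refine (H.rate.abs_iterFun_le hh hhb hπ (s + 1) (ξ m ω)).trans ?_
      have := H.rate.nonneg (ξ m ω)
      gcongr ?_ * _
      refine mul_le_mul_of_nonneg_left ?_ (mul_nonneg hb hC)
      exact pow_le_pow_of_le_one hρ.le hρl.le (Nat.le_succ s)
    have h3 := sq_le_sq' (by linarith [(abs_le.1 h1).1]) (abs_le.1 h1).2
    have h4 := sq_le_sq' (by linarith [(abs_le.1 h2).1]) (abs_le.1 h2).2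
    rw [innovation]
    nlinarith [sq_nonneg (iterFun P h s (ξ (m + 1) ω) + iterFun P h (s + 1) (ξ m ω))]
  -- Cauchy-Schwarz with weights `ρ ^ s`, half of the decay `ρ ^ (2 s)` of the squared innovations.
  have hpt : ∀ ω, quadIncrement P h ξ α n m ω ^ 2
      ≤ 1 / (1 - ρ) * ∑ j ∈ Finset.Icc (m + 1) n,
        2 * (b * C) ^ 2 * ρ ^ (j - (m + 1)) * w j ω := by
    intro ω
    have hw0 : ∀ j, 0 ≤ 2 * (b * C) ^ 2 * ρ ^ (j - (m + 1)) * w j ω := fun j => by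
      simp only [hw]
      positivity
    refine (Finset.sum_sq_le_sum_mul_sum_of_sq_le_mul (Finset.Icc (m + 1) n)
      (f := fun j => ρ ^ (j - (m + 1)))
      (g := fun j => 2 * (b * C) ^ 2 * ρ ^ (j - (m + 1)) * w j ω)
      (fun j _ => by positivity) (fun j _ => hw0 j) (fun j _ => ?_)).trans ?_
    · rw [mul_pow]
      calc _ ≤ (∑ i ∈ Finset.Icc 1 m, α i j * h (ξ i ω)) ^ 2 * (2 * (b * C) ^ 2
            * ρ ^ (j - (m + 1)) * ρ ^ (j - (m + 1))
            * (U (ξ (m + 1) ω) ^ 2 + U (ξ m ω) ^ 2)) := by gcongr; exact hD _ ω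
        _ = _ := by
          simp only [hw, hT]
          ring
    · exact mul_le_mul_of_nonneg_right hgeom (Finset.sum_nonneg fun j _ => hw0 j)
  calc ∫ ω, quadIncrement P h ξ α n m ω ^ 2 ∂μ
      ≤ ∫ ω, 1 / (1 - ρ) * ∑ j ∈ Finset.Icc (m + 1) n,
        2 * (b * C) ^ 2 * ρ ^ (j - (m + 1)) * w j ω ∂μ :=
        integral_mono (H.memLp_quadIncrement hh hhb hπ α n m).integrable_sq
          ((integrable_finsetSum _ fun j hj => (hwi j hj).const_mul _).const_mul _) hpt
    _ = 1 / (1 - ρ) * ∑ j ∈ Finset.Icc (m + 1) n,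
        2 * (b * C) ^ 2 * ρ ^ (j - (m + 1)) * ∫ ω, w j ω ∂μ := by
        rw [integral_const_mul, integral_finsetSum _ fun j hj => (hwi j hj).const_mul _]
        simp_rw [integral_const_mul]
    _ ≤ 1 / (1 - ρ) * ∑ j ∈ Finset.Icc (m + 1) n,
        2 * (b * C) ^ 2 * ρ ^ (j - (m + 1)) * (2 * K * N) := by
        gcongr with j hj
        exact hwb j hj
    _ = 1 / (1 - ρ) * (2 * (b * C) ^ 2 * (2 * K)
          * (∑ j ∈ Finset.Icc (m + 1) n, ρ ^ (j - (m + 1))) * N) := by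
        rw [Finset.mul_sum (a := 2 * (b * C) ^ 2 * (2 * K)), Finset.sum_mul]
        congr 1
        exact Finset.sum_congr rfl fun j _ => by ring
    _ ≤ 1 / (1 - ρ) * (2 * (b * C) ^ 2 * (2 * K) * (1 / (1 - ρ)) * N) := by gcongr
    _ = _ := by ring

/-- Second moments of quadratic forms in the `h (ξ i)`, `i ≤ n`, centred at the stationary
covariances. If every column of the coefficient array has at most `N` nonzero entries, the bound
is of order `n * N`, as it would be for independent variables. -/
theorem exists_integral_sq_quadForm_le [IsProbabilityMeasure π]
    (H : MixingChain μ ℱ P π ξ U C ρ M) {h : X → ℝ} {b : ℝ} (hb : 0 ≤ b)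
    (hh : Measurable h) (hhb : ∀ x, |h x| ≤ b * U x) (hπ : ∫ x, h x ∂π = 0) :
    ∃ K, 0 ≤ K ∧ ∀ (n N : ℕ) (α : ℕ → ℕ → ℝ), 1 ≤ N → (∀ i j, |α i j| ≤ 1) →
      (∀ j ≤ n, ((Finset.Icc 1 j).filter fun i => α i j ≠ 0).card ≤ N) →
      ∫ ω, (∑ j ∈ Finset.Icc 1 n, ∑ i ∈ Finset.Icc 1 j,
        α i j * (h (ξ i ω) * h (ξ j ω) - autocov P π h (j - i))) ^ 2 ∂μ ≤ K * (n * N) := by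
  obtain ⟨K, hK, hKb⟩ := H.exists_integral_sq_quadIncrement_le hb hh hhb hπ
  have hC := H.rate.C_nonneg
  have hρ := H.rate.rho_pos
  have hρl := H.rate.rho_lt_one
  have hρ1 : 0 < 1 - ρ := sub_pos.2 hρl
  have hM := H.moment_nonneg
  have hU2 := H.rate_sq.integral_nonneg
  set q := ∫ x, U x ^ 2 ∂π with hq
  set a := b ^ 2 * C * (1 + q) * (1 / (1 - ρ)) with ha_def
  have ha : 0 ≤ a := by positivity
  refine ⟨2 * (a * C * (a * M) * (2 / (1 - ρ)) + K), by positivity, fun n N α hN1 hα hN => ?_⟩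
  set ψ : ℕ → X → ℝ := fun l x => h x * iterFun P h l x - autocov P π h l with hψ
  have hψm : ∀ l, Measurable (ψ l) := fun l =>
    (hh.mul (measurable_iterFun P hh l)).sub measurable_const
  have hψb : ∀ l x, |ψ l x| ≤ b ^ 2 * C * (1 + q) * ρ ^ l * U x ^ 2 := by
    intro l x
    have h1 : |h x * iterFun P h l x| ≤ b ^ 2 * C * ρ ^ l * U x ^ 2 := by
      rw [abs_mul]
      calc _ ≤ (b * U x) * (b * C * ρ ^ l * U x) :=
            mul_le_mul (hhb x) (H.rate.abs_iterFun_le hh hhb hπ l x) (abs_nonneg _)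
              ((abs_nonneg _).trans (hhb x))
        _ = _ := by ring
    have h2 : b ^ 2 * C * q * ρ ^ l ≤ b ^ 2 * C * q * ρ ^ l * U x ^ 2 :=
      le_mul_of_one_le_right (by positivity) (H.rate_sq.one_le x)
    have h3 := H.abs_autocov_le hh hhb hπ l
    have h4 := abs_sub (h x * iterFun P h l x) (autocov P π h l)
    simp only [hψ]
    linarith
  have hψπ : ∀ l, ∫ x, ψ l x ∂π = 0 := by
    intro l
    have hi : Integrable (fun x => h x * iterFun P h l x) π :=
      H.rate_sq.integrable_of_le (a := b ^ 2 * C * ρ ^ l) (hh.mul (measurable_iterFun P hh l))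
        fun x => by
          rw [abs_mul]
          calc _ ≤ (b * U x) * (b * C * ρ ^ l * U x) :=
                mul_le_mul (hhb x) (H.rate.abs_iterFun_le hh hhb hπ l x) (abs_nonneg _)
                  ((abs_nonneg _).trans (hhb x))
            _ = _ := by ring
    have e : autocov P π h l = ∫ x, h x * iterFun P h l x ∂π := by
      simp only [autocov, hπ, sub_zero, iterFun]
    simp only [hψ]
    rw [integral_sub hi (integrable_const _), ← e]
    simp
  set Φ : ℕ → X → ℝ := fun i x => ∑ j ∈ Finset.Icc i n, α i j * ψ (j - i) x with hΦ
  have hΦb : ∀ i x, |Φ i x| ≤ a * U x ^ 2 := by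
    intro i x
    have hgeom : ∑ j ∈ Finset.Icc i n, ρ ^ (j - i) ≤ 1 / (1 - ρ) :=
      sum_pow_le_of_injOn hρ.le hρl _ _ fun x hx y hy hxy => by
        simp only [Finset.coe_Icc, Set.mem_Icc] at hx hy
        omega
    calc |Φ i x| ≤ ∑ j ∈ Finset.Icc i n, |α i j * ψ (j - i) x| := Finset.abs_sum_le_sum_abs _ _
      _ ≤ ∑ j ∈ Finset.Icc i n, b ^ 2 * C * (1 + q) * U x ^ 2 * ρ ^ (j - i) := by
        refine Finset.sum_le_sum fun j _ => ?_
        rw [abs_mul]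
        refine (mul_le_of_le_one_left (abs_nonneg _) (hα i j)).trans
          ((hψb (j - i) x).trans_eq ?_)
        ring
      _ ≤ b ^ 2 * C * (1 + q) * U x ^ 2 * (1 / (1 - ρ)) := by
        rw [← Finset.mul_sum]
        gcongr
      _ = _ := by rw [ha_def]; ring
  have hΦm : ∀ i, Measurable (Φ i) := fun i =>
    Finset.measurable_fun_sum _ fun j _ => (hψm _).const_mul _
  have hΦπ : ∀ i, ∫ x, Φ i x ∂π = 0 := by
    intro i
    simp only [hΦ]
    rw [integral_finsetSum]
    · simp_rw [integral_const_mul, hψπ, mul_zero, Finset.sum_const_zero]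
    · exact fun j _ => (H.rate_sq.integrable_of_le (hψm _) (hψb _)).const_mul _
  have hadd := H.integral_sq_sum_comp_le ha hΦm hΦb hΦπ (Finset.Icc 1 n)
  have hmart : ∫ ω, (∑ m ∈ Finset.range n, quadIncrement P h ξ α n m ω) ^ 2 ∂μ
      ≤ n * (K * N) := by
    rw [H.integral_sq_sum_quadIncrement hh hhb hπ]
    refine (Finset.sum_le_card_nsmul _ _ _ fun m _ => hKb n m N α hα fun j hj => ?_).trans_eq ?_
    · rw [Finset.mem_Icc] at hj
      exact (Finset.card_le_card (Finset.filter_subset_filter _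
        (Finset.Icc_subset_Icc_right (by omega)))).trans (hN j hj.2)
    rw [Finset.card_range, nsmul_eq_mul]
  have hL1 : MemLp (fun ω => ∑ i ∈ Finset.Icc 1 n, Φ i (ξ i ω)) 2 μ :=
    memLp_finsetSum _ fun i _ => H.memLp_comp_sq (hΦm i) (hΦb i) i
  have hL2 : MemLp (fun ω => ∑ m ∈ Finset.range n, quadIncrement P h ξ α n m ω) 2 μ :=
    memLp_finsetSum _ fun m _ => H.memLp_quadIncrement hh hhb hπ α n m
  have hdec : ∀ ω, ∑ j ∈ Finset.Icc 1 n, ∑ i ∈ Finset.Icc 1 j,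
      α i j * (h (ξ i ω) * h (ξ j ω) - autocov P π h (j - i))
      = ∑ i ∈ Finset.Icc 1 n, Φ i (ξ i ω)
        + ∑ m ∈ Finset.range n, quadIncrement P h ξ α n m ω :=
    fun ω => sum_sum_mul_sub_eq P hh ξ α _ n ω
  simp_rw [hdec]
  have hN1' : (1 : ℝ) ≤ N := by exact_mod_cast hN1
  rw [Nat.card_Icc, Nat.add_sub_cancel] at hadd
  calc _ ≤ ∫ ω, 2 * ((∑ i ∈ Finset.Icc 1 n, Φ i (ξ i ω)) ^ 2
        + (∑ m ∈ Finset.range n, quadIncrement P h ξ α n m ω) ^ 2) ∂μ :=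
        integral_mono (hL1.add hL2).integrable_sq
          ((hL1.integrable_sq.add hL2.integrable_sq).const_mul 2) fun ω => add_sq_le
    _ ≤ 2 * (a * C * (a * M) * (2 / (1 - ρ)) * n + n * (K * N)) := by
        rw [integral_const_mul, integral_add hL1.integrable_sq hL2.integrable_sq]
        gcongr
    _ ≤ 2 * (a * C * (a * M) * (2 / (1 - ρ)) * (n * N) + n * (K * N)) := by
        gcongr
        exact le_mul_of_one_le_right (Nat.cast_nonneg n) hN1'
    _ = _ := by ring

end MixingChain

end Quadratic

/-! ### Sums over lags and centring at the empirical mean -/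

section LagWeights

/-- The number of lags in `ℤ` of absolute value `l`. -/
noncomputable def lagMult (l : ℕ) : ℝ := if l = 0 then 1 else 2

theorem lagMult_nonneg (l : ℕ) : 0 ≤ lagMult l := by
  unfold lagMult; split_ifs <;> norm_num

theorem lagMult_le_two (l : ℕ) : lagMult l ≤ 2 := by
  unfold lagMult; split_ifs <;> norm_num

theorem sum_Icc_neg_natAbs (f : ℕ → ℝ) (n : ℕ) :
    ∑ k ∈ Finset.Icc (-(n : ℤ) + 1) ((n : ℤ) - 1), f k.natAbs
      = ∑ l ∈ Finset.range n, lagMult l * f l := by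
  induction n with
  | zero => simp
  | succ n ih =>
    rw [Finset.sum_range_succ, ← ih]
    rcases n.eq_zero_or_pos with rfl | hn
    · simp [lagMult]
    · have e : Finset.Icc (-((n + 1 : ℕ) : ℤ) + 1) (((n + 1 : ℕ) : ℤ) - 1)
          = insert (n : ℤ) (insert (-(n : ℤ)) (Finset.Icc (-(n : ℤ) + 1) ((n : ℤ) - 1))) := by
        ext k
        simp only [Finset.mem_insert, Finset.mem_Icc]
        omega
      rw [e, Finset.sum_insert, Finset.sum_insert]
      · rw [Int.natAbs_neg, Int.natAbs_natCast, lagMult, if_neg hn.ne']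
        ring
      · simp
      · simp only [Finset.mem_insert, Finset.mem_Icc]
        omega

theorem hasSum_lagMult_mul {f : ℕ → ℝ} (hf : Summable f) :
    HasSum (fun l => lagMult l * f l) (∑' l : ℤ, f l.natAbs) := by
  have h1 : HasSum (fun l => f l.natAbs : ℤ → ℝ) ((∑' l, f l) + ∑' l, f (l + 1)) := by
    refine HasSum.of_nat_of_neg_add_one ?_ ?_
    · simpa using hf.hasSum
    · have : ∀ l : ℕ, (-((l : ℤ) + 1)).natAbs = l + 1 := fun l => by omega
      simp only [this]
      exact ((summable_nat_add_iff 1).2 hf).hasSum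
  rw [h1.tsum_eq, ← hasSum_nat_add_iff' 1]
  have h2 : HasSum (fun l => f (l + 1)) (∑' l, f (l + 1)) :=
    ((summable_nat_add_iff 1).2 hf).hasSum
  have e1 : (fun l => lagMult (l + 1) * f (l + 1)) = fun l => 2 * f (l + 1) := by
    funext l
    simp [lagMult]
  have e2 : (∑' l, f l) + ∑' l, f (l + 1) - ∑ i ∈ Finset.range 1, lagMult i * f i
      = 2 * ∑' l, f (l + 1) := by
    rw [hf.tsum_eq_zero_add]
    simp [lagMult]
    ring
  rw [e1, e2]
  exact h2.mul_left 2

/-- Summation by lag is summation over the pairs `i ≤ j`. -/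
theorem sum_range_sum_Icc_eq (F : ℕ → ℕ → ℕ → ℝ) (n : ℕ) :
    ∑ l ∈ Finset.range n, ∑ i ∈ Finset.Icc 1 (n - l), F l i (i + l)
      = ∑ j ∈ Finset.Icc 1 n, ∑ i ∈ Finset.Icc 1 j, F (j - i) i j := by
  rw [Finset.sum_sigma', Finset.sum_sigma']
  refine Finset.sum_nbij' (fun x => ⟨x.2 + x.1, x.2⟩) (fun x => ⟨x.1 - x.2, x.2⟩) ?_ ?_ ?_ ?_ ?_
  · rintro ⟨l, i⟩ hx
    simp only [Finset.mem_sigma, Finset.mem_range, Finset.mem_Icc] at hx ⊢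
    omega
  · rintro ⟨j, i⟩ hx
    simp only [Finset.mem_sigma, Finset.mem_range, Finset.mem_Icc] at hx ⊢
    omega
  · rintro ⟨l, i⟩ _
    simp
  · rintro ⟨j, i⟩ hx
    simp only [Finset.mem_sigma, Finset.mem_Icc] at hx
    simp [Nat.add_sub_cancel' hx.2.2]
  · rintro ⟨l, i⟩ _
    simp

theorem sum_sum_eq_sum_sum_le (f : ℕ → ℕ → ℝ) (n : ℕ) :
    ∑ i ∈ Finset.Icc 1 n, ∑ j ∈ Finset.Icc 1 n, f i j
      = ∑ j ∈ Finset.Icc 1 n, ∑ i ∈ Finset.Icc 1 j, (f i j + if i < j then f j i else 0) := by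
  have h1 : ∀ i ∈ Finset.Icc 1 n, ∑ j ∈ Finset.Icc 1 n, f i j
      = ∑ j ∈ Finset.Icc i n, f i j + ∑ j ∈ Finset.Icc 1 i, if j < i then f i j else 0 := by
    intro i hi
    rw [Finset.mem_Icc] at hi
    have e1 : Finset.Icc i n = (Finset.Icc 1 n).filter fun j => ¬ j < i := by
      ext j
      simp only [Finset.mem_filter, Finset.mem_Icc]
      omega
    have e2 : (Finset.Icc 1 i).filter (fun j => j < i)
        = (Finset.Icc 1 n).filter fun j => j < i := by
      ext j
      simp only [Finset.mem_filter, Finset.mem_Icc]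
      omega
    rw [← Finset.sum_filter, e1, e2, add_comm, Finset.sum_filter_add_sum_filter_not]
  rw [Finset.sum_congr rfl h1, Finset.sum_add_distrib]
  simp_rw [Finset.sum_add_distrib]
  congr 1
  refine Finset.sum_comm' fun i j => ?_
  simp only [Finset.mem_Icc]
  omega

/-- The weight of the lag `l ≥ 0` in `lagWindowEst`, counting both signs. -/
noncomputable def lagWeight (w : ℝ → ℝ) (c : ℝ) (l : ℕ) : ℝ := lagMult l * w (l / c)

theorem IsWeight.lagWeight_nonneg {w : ℝ → ℝ} (hw : IsWeight w) (c : ℝ) (l : ℕ) :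
    0 ≤ lagWeight w c l := mul_nonneg (lagMult_nonneg l) (hw.nonneg _)

theorem IsWeight.lagWeight_le_two {w : ℝ → ℝ} (hw : IsWeight w) (c : ℝ) (l : ℕ) :
    lagWeight w c l ≤ 2 :=
  (mul_le_of_le_one_right (lagMult_nonneg l) (hw.le_one _)).trans (lagMult_le_two l)

theorem IsWeight.le_of_lagWeight_ne_zero {w : ℝ → ℝ} (hw : IsWeight w) {c : ℝ} (hc : 0 < c)
    {l : ℕ} (hl : lagWeight w c l ≠ 0) : l ≤ ⌊c⌋₊ := by
  by_contra hlt
  rw [not_le, Nat.floor_lt hc.le] at hlt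
  refine hl ?_
  rw [lagWeight, hw.support, mul_zero]
  rw [abs_of_nonneg (by positivity), one_lt_div hc]
  exact hlt

theorem IsWeight.card_filter_lagWeight_le {w : ℝ → ℝ} (hw : IsWeight w) {c : ℝ} (hc : 0 < c)
    (S : Finset ℕ) (e : ℕ → ℕ) (he : Set.InjOn e S) :
    (S.filter fun i => lagWeight w c (e i) ≠ 0).card ≤ ⌊c⌋₊ + 1 := by
  rw [← Finset.card_range (⌊c⌋₊ + 1)]
  refine Finset.card_le_card_of_injOn e (fun i hi => ?_)
    (he.mono fun i hi => (Finset.mem_filter.1 hi).1)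
  have := hw.le_of_lagWeight_ne_zero hc (Finset.mem_filter.1 hi).2
  simp only [Finset.coe_range, Set.mem_Iio]
  omega

theorem IsWeight.sum_lagWeight_le {w : ℝ → ℝ} (hw : IsWeight w) {c : ℝ} (hc : 0 < c)
    (S : Finset ℕ) (e : ℕ → ℕ) (he : Set.InjOn e S) :
    ∑ i ∈ S, lagWeight w c (e i) ≤ 2 * (c + 1) := by
  rw [← Finset.sum_filter_ne_zero]
  refine (Finset.sum_le_card_nsmul _ _ 2 fun i _ => hw.lagWeight_le_two c _).trans ?_
  rw [nsmul_eq_mul, mul_comm]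
  have h1 : ((S.filter fun i => lagWeight w c (e i) ≠ 0).card : ℝ) ≤ ⌊c⌋₊ + 1 := by
    exact_mod_cast hw.card_filter_lagWeight_le hc S e he
  have h2 := Nat.floor_le hc.le
  linarith

end LagWeights

section Centering

/-- The coefficients, up to the factor `n⁻¹`, of the quadratic form that centring at the empirical
mean adds to `∑ i ≤ j ≤ n, b (j - i) * y i * y j`. -/
noncomputable def centeringCoeff (b : ℕ → ℝ) (n i : ℕ) : ℝ :=
  (n : ℝ)⁻¹ * ∑ j ∈ Finset.Icc 1 n, ∑ i ∈ Finset.Icc 1 j, b (j - i)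
    - (∑ j ∈ Finset.Icc i n, b (j - i) + ∑ j ∈ Finset.Icc 1 i, b (i - j))

theorem sum_centered_eq (b y : ℕ → ℝ) (n : ℕ) (m : ℝ)
    (hm : m = (n : ℝ)⁻¹ * ∑ k ∈ Finset.Icc 1 n, y k) :
    ∑ j ∈ Finset.Icc 1 n, ∑ i ∈ Finset.Icc 1 j, b (j - i) * ((y i - m) * (y j - m))
      = ∑ j ∈ Finset.Icc 1 n, ∑ i ∈ Finset.Icc 1 j, b (j - i) * (y i * y j)
        + (n : ℝ)⁻¹ * ∑ i ∈ Finset.Icc 1 n, ∑ p ∈ Finset.Icc 1 n,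
          centeringCoeff b n i * (y i * y p) := by
  set s := ∑ j ∈ Finset.Icc 1 n, ∑ i ∈ Finset.Icc 1 j, b (j - i) with hs
  set t := ∑ k ∈ Finset.Icc 1 n, y k with ht
  have h1 : ∑ j ∈ Finset.Icc 1 n, ∑ i ∈ Finset.Icc 1 j, b (j - i) * (y i + y j)
      = ∑ i ∈ Finset.Icc 1 n,
        (∑ j ∈ Finset.Icc i n, b (j - i) + ∑ j ∈ Finset.Icc 1 i, b (i - j)) * y i := by
    simp_rw [mul_add, add_mul, Finset.sum_add_distrib, Finset.sum_mul]
    congr 1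
    refine Finset.sum_comm' fun i j => ?_
    simp only [Finset.mem_Icc]
    omega
  have h2 : ∀ j i, b (j - i) * ((y i - m) * (y j - m))
      = b (j - i) * (y i * y j) - m * (b (j - i) * (y i + y j)) + m ^ 2 * b (j - i) :=
    fun j i => by ring
  have h3 : ∑ i ∈ Finset.Icc 1 n, ∑ p ∈ Finset.Icc 1 n, centeringCoeff b n i * (y i * y p)
      = t * ((n : ℝ)⁻¹ * s * t - ∑ i ∈ Finset.Icc 1 n,
        (∑ j ∈ Finset.Icc i n, b (j - i) + ∑ j ∈ Finset.Icc 1 i, b (i - j)) * y i) := by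
    simp_rw [← mul_assoc, ← Finset.mul_sum, ← ht, centeringCoeff, ← hs]
    rw [← Finset.sum_mul, mul_comm t]
    simp_rw [sub_mul, Finset.sum_sub_distrib, ← Finset.mul_sum, ← ht]
    ring
  rw [h3]
  simp_rw [h2, Finset.sum_add_distrib, Finset.sum_sub_distrib, ← Finset.mul_sum, h1, ← hs]
  rw [hm]
  ring

end Centering

/-! ### Bias and mean square error of the lag-window estimator -/

/-- Bias of a lag-window sum: the lag `l` enters with total weight `w (l / c) * (1 - l / n)`, which
differs from `1` by at most `(L / c + 1 / n) * l`. -/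
theorem IsWeight.abs_lagWeight_sum_sub_le {w : ℝ → ℝ} (hw : IsWeight w) {L : ℝ}
    (hL : ∀ u, |1 - w u| ≤ L * |u|) {γ : ℕ → ℝ} {G ρ : ℝ} (hρ : 0 ≤ ρ) (hρ1 : ρ < 1)
    (hγ : ∀ l, |γ l| ≤ G * ρ ^ l) {n : ℕ} (hn : 1 ≤ n) {c : ℝ} (hc : 0 < c) :
    |(n : ℝ)⁻¹ * ∑ l ∈ Finset.range n, ∑ _i ∈ Finset.Icc 1 (n - l), lagWeight w c l * γ l
      - ∑' l : ℤ, γ l.natAbs| ≤ (L / c + 1 / n) * (2 * G * ∑' l : ℕ, l * ρ ^ l) := by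
  have hn0 : (0 : ℝ) < n := by exact_mod_cast hn
  have hsum : Summable γ := Summable.of_norm_bounded
    ((summable_geometric_of_lt_one hρ hρ1).mul_left G) hγ
  have hS := hasSum_lagMult_mul hsum
  set g : ℕ → ℝ := fun l => if l < n then lagWeight w c l * (1 - l / n) * γ l else 0 with hg
  have hF : HasSum g ((n : ℝ)⁻¹ * ∑ l ∈ Finset.range n,
      ∑ _i ∈ Finset.Icc 1 (n - l), lagWeight w c l * γ l) := by
    have e : (n : ℝ)⁻¹ * ∑ l ∈ Finset.range n,
        ∑ _i ∈ Finset.Icc 1 (n - l), lagWeight w c l * γ l = ∑ l ∈ Finset.range n, g l := by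
      rw [Finset.mul_sum]
      refine Finset.sum_congr rfl fun l hl => ?_
      rw [Finset.mem_range] at hl
      rw [Finset.sum_const, Nat.card_Icc, Nat.add_sub_cancel, nsmul_eq_mul, Nat.cast_sub hl.le]
      simp only [hg, if_pos hl]
      field_simp
    rw [e]
    refine hasSum_sum_of_ne_finset_zero fun l hl => ?_
    rw [Finset.mem_range] at hl
    simp only [hg, if_neg hl]
  have hbd : ∀ l, ‖g l - lagMult l * γ l‖ ≤ (L / c + 1 / n) * (2 * G * (l * ρ ^ l)) := by
    intro l
    have h1 : |(if l < n then w (l / c) * (1 - l / n) else 0) - 1| ≤ (L / c + 1 / n) * l := by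
      have h2 := hL (l / c)
      have h0 : (0 : ℝ) ≤ l / c := by positivity
      rw [abs_of_nonneg h0] at h2
      have e : (L / c + 1 / n) * l = L * (l / c) + l / n := by ring
      rw [e]
      split_ifs with h
      · have h3 : |w (l / c) * (l / n)| ≤ l / n := by
          rw [abs_of_nonneg (mul_nonneg (hw.nonneg _) (by positivity))]
          exact mul_le_of_le_one_left (by positivity) (hw.le_one _)
        have e2 : w (l / c) * (1 - l / n) - 1 = -((1 - w (l / c)) + w (l / c) * (l / n)) := by ring
        rw [e2, abs_neg]
        exact (abs_add_le _ _).trans (add_le_add h2 h3)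
      · have h3 : (1 : ℝ) ≤ l / n := by
          rw [one_le_div hn0]
          exact_mod_cast not_lt.1 h
        have h4 := (abs_nonneg _).trans h2
        rw [zero_sub, abs_neg, abs_one]
        linarith
    have e : g l - lagMult l * γ l
        = ((if l < n then w (l / c) * (1 - l / n) else 0) - 1) * (lagMult l * γ l) := by
      simp only [hg, lagWeight]
      split_ifs <;> ring
    have h5 : |lagMult l * γ l| ≤ 2 * (G * ρ ^ l) := by
      rw [abs_mul, abs_of_nonneg (lagMult_nonneg l)]
      exact mul_le_mul (lagMult_le_two l) (hγ l) (abs_nonneg _) zero_le_two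
    rw [e, Real.norm_eq_abs, abs_mul]
    calc _ ≤ ((L / c + 1 / n) * l) * (2 * (G * ρ ^ l)) :=
          mul_le_mul h1 h5 (abs_nonneg _) ((abs_nonneg _).trans h1)
      _ = _ := by ring
  have hρs : Summable fun l : ℕ => (l : ℝ) * ρ ^ l := by
    simpa using summable_pow_mul_geometric_of_norm_lt_one 1
      (r := ρ) (by rwa [Real.norm_of_nonneg hρ])
  exact (hF.sub hS).norm_le_of_bounded ((hρs.hasSum.mul_left (2 * G)).mul_left _) hbd

theorem abs_centeringCoeff_lagWeight_le {w : ℝ → ℝ} (hw : IsWeight w) {c : ℝ} (hc : 0 < c)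
    {n : ℕ} (hn : 1 ≤ n) (i : ℕ) : |centeringCoeff (lagWeight w c) n i| ≤ 6 * (c + 1) := by
  have hn0 : (0 : ℝ) < n := by exact_mod_cast hn
  have h0 := hw.lagWeight_nonneg c
  have hcol : ∀ j, ∑ i ∈ Finset.Icc 1 j, lagWeight w c (j - i) ≤ 2 * (c + 1) := fun j =>
    hw.sum_lagWeight_le hc _ _ fun x hx y hy hxy => by
      simp only [Finset.coe_Icc, Set.mem_Icc] at hx hy
      omega
  have hrow : ∑ j ∈ Finset.Icc i n, lagWeight w c (j - i) ≤ 2 * (c + 1) :=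
    hw.sum_lagWeight_le hc _ _ fun x hx y hy hxy => by
      simp only [Finset.coe_Icc, Set.mem_Icc] at hx hy
      omega
  have hs : (n : ℝ)⁻¹ * ∑ j ∈ Finset.Icc 1 n, ∑ i ∈ Finset.Icc 1 j, lagWeight w c (j - i)
      ≤ 2 * (c + 1) := by
    rw [inv_mul_le_iff₀ hn0]
    refine (Finset.sum_le_card_nsmul _ _ _ fun j _ => hcol j).trans_eq ?_
    rw [Nat.card_Icc, Nat.add_sub_cancel, nsmul_eq_mul]
  have hs0 : 0 ≤ (n : ℝ)⁻¹ * ∑ j ∈ Finset.Icc 1 n, ∑ i ∈ Finset.Icc 1 j,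
      lagWeight w c (j - i) :=
    mul_nonneg (by positivity) (Finset.sum_nonneg fun j _ => Finset.sum_nonneg fun i _ => h0 _)
  have hrow0 : 0 ≤ ∑ j ∈ Finset.Icc i n, lagWeight w c (j - i) :=
    Finset.sum_nonneg fun j _ => h0 _
  have hcol0 : 0 ≤ ∑ j ∈ Finset.Icc 1 i, lagWeight w c (i - j) :=
    Finset.sum_nonneg fun j _ => h0 _
  have := hcol i
  rw [centeringCoeff, abs_le]
  constructor <;> linarith

/-- The lag-window estimator as a quadratic form: a banded one, and a correction by the centring
whose coefficients are of order `c / n` but fill the whole `n × n` square. -/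
theorem lagWindowEst_eq {Ω X : Type*} {w : ℝ → ℝ} (hw : IsWeight w) (c : ℕ → ℝ) (h : X → ℝ)
    (ξ : ℕ → Ω → X) (n : ℕ) (ω : Ω) :
    lagWindowEst w c h ξ n ω
      = (n : ℝ)⁻¹ * ∑ j ∈ Finset.Icc 1 n, ∑ i ∈ Finset.Icc 1 j,
          lagWeight w (c n) (j - i) * (h (ξ i ω) * h (ξ j ω))
        + (n : ℝ)⁻¹ * ((n : ℝ)⁻¹ * ∑ i ∈ Finset.Icc 1 n, ∑ p ∈ Finset.Icc 1 n,
          centeringCoeff (lagWeight w (c n)) n i * (h (ξ i ω) * h (ξ p ω))) := by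
  have hwabs : ∀ k : ℤ, w ((k : ℝ) / c n) = w ((k.natAbs : ℝ) / c n) := by
    intro k
    rcases Int.natAbs_eq k with hk | hk
    · rw [hk]; simp
    · rw [hk]; simp [neg_div, hw.even]
  rw [← mul_add, ← sum_centered_eq _ (fun i => h (ξ i ω)) n (empMean h ξ n ω) rfl,
    ← sum_range_sum_Icc_eq (fun l i j => lagWeight w (c n) l
      * ((h (ξ i ω) - empMean h ξ n ω) * (h (ξ j ω) - empMean h ξ n ω))), lagWindowEst]
  simp_rw [hwabs]
  rw [sum_Icc_neg_natAbs (fun l => w (l / c n) * sampleAutocov h ξ n l ω), Finset.mul_sum]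
  refine Finset.sum_congr rfl fun l _ => ?_
  rw [← Finset.mul_sum, lagWeight, sampleAutocov]
  ring

section Chain

variable {Ω X : Type*} [mΩ : MeasurableSpace Ω] [MeasurableSpace X]
  {μ : Measure Ω} [IsProbabilityMeasure μ] {ℱ : Filtration ℕ mΩ} {P : Kernel X X}
  {π : Measure X} {ξ : ℕ → Ω → X} {U : X → ℝ} {C ρ M : ℝ}

namespace MixingChain

/-- Second moments of quadratic forms without centring and without band structure. -/
theorem exists_integral_sq_fullForm_le [IsProbabilityMeasure π]
    (H : MixingChain μ ℱ P π ξ U C ρ M) {h : X → ℝ} {b : ℝ} (hb : 0 ≤ b)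
    (hh : Measurable h) (hhb : ∀ x, |h x| ≤ b * U x) (hπ : ∫ x, h x ∂π = 0) :
    ∃ K, 0 ≤ K ∧ ∀ (n : ℕ) (α : ℕ → ℕ → ℝ) (κ : ℝ), 1 ≤ n → 0 < κ → (∀ i j, |α i j| ≤ κ) →
      ∫ ω, (∑ i ∈ Finset.Icc 1 n, ∑ j ∈ Finset.Icc 1 n,
        α i j * (h (ξ i ω) * h (ξ j ω))) ^ 2 ∂μ ≤ K * (κ * n) ^ 2 := by
  obtain ⟨K, hK, hKb⟩ := H.exists_integral_sq_quadForm_le hb hh hhb hπ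
  have hC := H.rate.C_nonneg
  have hρ := H.rate.rho_pos
  have hρl := H.rate.rho_lt_one
  have hρ1 : 0 < 1 - ρ := sub_pos.2 hρl
  have hU2 := H.rate_sq.integral_nonneg
  set G := b ^ 2 * C * ∫ x, U x ^ 2 ∂π with hG
  have hG0 : 0 ≤ G := by positivity
  have hγ := H.abs_autocov_le hh hhb hπ
  rw [← hG] at hγ
  refine ⟨8 * (K + (G * (1 / (1 - ρ))) ^ 2), by positivity, fun n α κ hn hκ hα => ?_⟩
  set β : ℕ → ℕ → ℝ := fun i j => (2 * κ)⁻¹ * (α i j + if i < j then α j i else 0) with hβ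
  have hβ1 : ∀ i j, |β i j| ≤ 1 := by
    intro i j
    have h1 : |α i j + if i < j then α j i else 0| ≤ 2 * κ := by
      refine (abs_add_le _ _).trans ?_
      have h2 := hα i j
      split_ifs
      · have := hα j i
        linarith
      · rw [abs_zero]
        linarith
    rw [hβ, abs_mul, abs_of_pos (by positivity), inv_mul_le_iff₀ (by positivity), mul_one]
    exact h1
  -- Folding onto `i ≤ j` at most doubles the coefficients, hence the factor `(2 * κ)⁻¹` in `β`.
  have hQ := hKb n n β hn hβ1 fun j hj =>
    (Finset.card_filter_le _ _).trans (by rw [Nat.card_Icc]; omega)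
  have hmean : |∑ j ∈ Finset.Icc 1 n, ∑ i ∈ Finset.Icc 1 j, β i j * autocov P π h (j - i)|
      ≤ n * (G * (1 / (1 - ρ))) := by
    refine (Finset.abs_sum_le_sum_abs _ _).trans ?_
    refine (Finset.sum_le_card_nsmul _ _ (G * (1 / (1 - ρ))) fun j _ => ?_).trans_eq ?_
    · refine (Finset.abs_sum_le_sum_abs _ _).trans ?_
      calc _ ≤ ∑ i ∈ Finset.Icc 1 j, G * ρ ^ (j - i) := by
            refine Finset.sum_le_sum fun i _ => ?_
            rw [abs_mul]
            exact (mul_le_of_le_one_left (abs_nonneg _) (hβ1 i j)).trans (hγ _)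
        _ ≤ _ := by
            rw [← Finset.mul_sum]
            refine mul_le_mul_of_nonneg_left ?_ hG0
            exact sum_pow_le_of_injOn hρ.le hρl _ _ fun x hx y hy hxy => by
              simp only [Finset.coe_Icc, Set.mem_Icc] at hx hy
              omega
    · rw [Nat.card_Icc, Nat.add_sub_cancel, nsmul_eq_mul]
  set E := ∑ j ∈ Finset.Icc 1 n, ∑ i ∈ Finset.Icc 1 j, β i j * autocov P π h (j - i)
  set R : Ω → ℝ := fun ω => ∑ j ∈ Finset.Icc 1 n, ∑ i ∈ Finset.Icc 1 j,
    β i j * (h (ξ i ω) * h (ξ j ω) - autocov P π h (j - i)) with hR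
  have hRL : MemLp R 2 μ := memLp_finsetSum _ fun j _ => memLp_finsetSum _ fun i _ =>
    (H.memLp_mul_sub hh hhb i j _).const_mul _
  have e : ∀ ω, ∑ i ∈ Finset.Icc 1 n, ∑ j ∈ Finset.Icc 1 n, α i j * (h (ξ i ω) * h (ξ j ω))
      = 2 * κ * (R ω + E) := by
    intro ω
    rw [sum_sum_eq_sum_sum_le]
    simp only [hR, E, hβ]
    simp_rw [← Finset.sum_add_distrib, Finset.mul_sum]
    refine Finset.sum_congr rfl fun j _ => Finset.sum_congr rfl fun i _ => ?_
    split_ifs <;> field_simp <;> ring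
  have hE2 : E ^ 2 ≤ (n * (G * (1 / (1 - ρ)))) ^ 2 :=
    sq_le_sq' (abs_le.1 hmean).1 (abs_le.1 hmean).2
  simp_rw [e]
  calc ∫ ω, (2 * κ * (R ω + E)) ^ 2 ∂μ ≤ ∫ ω, 8 * κ ^ 2 * (R ω ^ 2 + E ^ 2) ∂μ := by
        refine integral_mono ((hRL.add (memLp_const E)).const_mul _).integrable_sq
          ((hRL.integrable_sq.add (integrable_const _)).const_mul _) fun ω => ?_
        have := add_sq_le (a := R ω) (b := E)
        have hκ2 := sq_nonneg κ
        simp only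
        nlinarith
    _ = 8 * κ ^ 2 * (∫ ω, R ω ^ 2 ∂μ + E ^ 2) := by
        rw [integral_const_mul, integral_add hRL.integrable_sq (integrable_const _)]
        simp
    _ ≤ 8 * κ ^ 2 * (K * (n * n) + (n * (G * (1 / (1 - ρ)))) ^ 2) := by gcongr
    _ = _ := by ring

theorem memLp_lagWindowEst_sub (H : MixingChain μ ℱ P π ξ U C ρ M) {h : X → ℝ}
    {b : ℝ} (hh : Measurable h) (hhb : ∀ x, |h x| ≤ b * U x) (w : ℝ → ℝ) (c : ℕ → ℝ) (n : ℕ) :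
    MemLp (fun ω => lagWindowEst w c h ξ n ω - 1) 2 μ := by
  have hm : MemLp (empMean h ξ n) 4 μ :=
    (memLp_finsetSum _ fun k _ => H.memLp_comp hh hhb k).const_mul _
  refine MemLp.sub ?_ (memLp_const 1)
  refine memLp_finsetSum _ fun k _ => MemLp.const_mul (MemLp.const_mul ?_ _) _
  exact memLp_finsetSum _ fun j _ =>
    memLp_two_mul ((H.memLp_comp hh hhb _).sub hm) ((H.memLp_comp hh hhb _).sub hm)

/-- The non-asymptotic mean square error bound: variance of order `c / n`, bias of order `1 / c`. -/
theorem exists_integral_sq_lagWindowEst_sub_le [IsProbabilityMeasure π]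
    (H : MixingChain μ ℱ P π ξ U C ρ M) {h : X → ℝ}
    {b : ℝ} (hb : 0 ≤ b) (hh : Measurable h) (hhb : ∀ x, |h x| ≤ b * U x)
    (hπ : ∫ x, h x ∂π = 0) (hvar : asympVar P π h = 1) {w : ℝ → ℝ} (hw : IsWeight w) {L : ℝ}
    (hL : ∀ u, |1 - w u| ≤ L * |u|) :
    ∃ K, 0 ≤ K ∧ ∀ (c : ℕ → ℝ) (n : ℕ), 1 ≤ n → 1 ≤ c n → c n ≤ n →
      ∫ ω, (lagWindowEst w c h ξ n ω - 1) ^ 2 ∂μ ≤ K * ((1 / c n) ^ 2 + c n / n) := by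
  obtain ⟨K₁, hK₁, hb₁⟩ := H.exists_integral_sq_quadForm_le hb hh hhb hπ
  obtain ⟨K₂, hK₂, hb₂⟩ := H.exists_integral_sq_fullForm_le hb hh hhb hπ
  have hC := H.rate.C_nonneg
  have hρ := H.rate.rho_pos
  have hρl := H.rate.rho_lt_one
  have hU2 := H.rate_sq.integral_nonneg
  set G := b ^ 2 * C * ∫ x, U x ^ 2 ∂π with hG
  have hG0 : 0 ≤ G := by positivity
  have hγ := H.abs_autocov_le hh hhb hπ
  rw [← hG] at hγ
  have hL0 : 0 ≤ L := by
    have := (abs_nonneg _).trans (hL 1)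
    simpa using this
  set K₃ := 2 * G * ∑' l : ℕ, (l : ℝ) * ρ ^ l with hK₃
  have hK₃0 : 0 ≤ K₃ := mul_nonneg (by positivity) (tsum_nonneg fun l => by positivity)
  refine ⟨3 * (8 * K₁ + 144 * K₂ + ((L + 1) * K₃) ^ 2), by positivity, fun c n hn hc1 hcn => ?_⟩
  have hn0 : (0 : ℝ) < n := by exact_mod_cast hn
  have hc : 0 < c n := by linarith
  set v := lagWeight w (c n) with hv
  set S₁ : Ω → ℝ := fun ω => ∑ j ∈ Finset.Icc 1 n, ∑ i ∈ Finset.Icc 1 j,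
    v (j - i) / 2 * (h (ξ i ω) * h (ξ j ω) - autocov P π h (j - i)) with hS₁
  set S₂ : Ω → ℝ := fun ω => ∑ i ∈ Finset.Icc 1 n, ∑ p ∈ Finset.Icc 1 n,
    centeringCoeff v n i * (h (ξ i ω) * h (ξ p ω)) with hS₂
  set B := (n : ℝ)⁻¹ * ∑ j ∈ Finset.Icc 1 n, ∑ i ∈ Finset.Icc 1 j,
    v (j - i) * autocov P π h (j - i) - 1 with hB
  have hdec : ∀ ω, lagWindowEst w c h ξ n ω - 1
      = 2 * (n : ℝ)⁻¹ * S₁ ω + (n : ℝ)⁻¹ * ((n : ℝ)⁻¹ * S₂ ω) + B := by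
    intro ω
    have e : 2 * S₁ ω = ∑ j ∈ Finset.Icc 1 n, ∑ i ∈ Finset.Icc 1 j,
        v (j - i) * (h (ξ i ω) * h (ξ j ω)) - ∑ j ∈ Finset.Icc 1 n, ∑ i ∈ Finset.Icc 1 j,
        v (j - i) * autocov P π h (j - i) := by
      simp only [hS₁]
      simp_rw [← Finset.sum_sub_distrib, Finset.mul_sum]
      exact Finset.sum_congr rfl fun j _ => Finset.sum_congr rfl fun i _ => by ring
    rw [lagWindowEst_eq hw, mul_right_comm, e, hB]
    ring
  have hL₁ : MemLp S₁ 2 μ := memLp_finsetSum _ fun j _ => memLp_finsetSum _ fun i _ =>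
    (H.memLp_mul_sub hh hhb i j _).const_mul _
  have hL₂ : MemLp S₂ 2 μ := memLp_finsetSum _ fun i _ => memLp_finsetSum _ fun p _ =>
    (memLp_two_mul (H.memLp_comp hh hhb i) (H.memLp_comp hh hhb p)).const_mul _
  have hfl : ((⌊c n⌋₊ + 1 : ℕ) : ℝ) ≤ 2 * c n := by
    push_cast
    linarith [Nat.floor_le hc.le]
  have hE₁ : ∫ ω, S₁ ω ^ 2 ∂μ ≤ K₁ * (n * (2 * c n)) := by
    refine (hb₁ n (⌊c n⌋₊ + 1) (fun i j => v (j - i) / 2) (by omega) (fun i j => ?_)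
      fun j _ => ?_).trans ?_
    · rw [abs_of_nonneg (div_nonneg (hw.lagWeight_nonneg _ _) zero_le_two)]
      have := hw.lagWeight_le_two (c n) (j - i)
      linarith
    · have e : ∀ i, v (j - i) / 2 ≠ 0 ↔ v (j - i) ≠ 0 := fun i => by simp
      simp_rw [e]
      exact hw.card_filter_lagWeight_le hc _ _ fun x hx y hy hxy => by
        simp only [Finset.coe_Icc, Set.mem_Icc] at hx hy
        omega
    · gcongr
  -- The coefficients of `S₂` are at most `6 * (c n + 1) ≤ 12 * c n`.
  have hE₂ : ∫ ω, S₂ ω ^ 2 ∂μ ≤ K₂ * (12 * c n * n) ^ 2 :=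
    hb₂ n _ (12 * c n) hn (by positivity) fun i _ =>
      (abs_centeringCoeff_lagWeight_le hw hc hn i).trans (by linarith)
  have hBb : |B| ≤ (L + 1) * K₃ * (1 / c n) := by
    have h1 := hw.abs_lagWeight_sum_sub_le hL hρ.le hρl hγ hn hc
    rw [← hK₃, sum_range_sum_Icc_eq (fun l _ _ => lagWeight w (c n) l * autocov P π h l)] at h1
    rw [asympVar] at hvar
    rw [hvar] at h1
    refine h1.trans ?_
    have h2 : 1 / (n : ℝ) ≤ 1 / c n := one_div_le_one_div_of_le hc hcn
    calc (L / c n + 1 / n) * K₃ ≤ (L / c n + 1 / c n) * K₃ := by gcongr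
      _ = _ := by ring
  have hB2 : B ^ 2 ≤ ((L + 1) * K₃ * (1 / c n)) ^ 2 := sq_le_sq' (abs_le.1 hBb).1 (abs_le.1 hBb).2
  have hcn1 : c n / n ≤ 1 := (div_le_one hn0).2 hcn
  have hcn0 : 0 ≤ c n / n := by positivity
  have hi : Integrable (fun ω => 4 * ((n : ℝ)⁻¹) ^ 2 * S₁ ω ^ 2
      + ((n : ℝ)⁻¹) ^ 4 * S₂ ω ^ 2) μ :=
    (hL₁.integrable_sq.const_mul _).add (hL₂.integrable_sq.const_mul _)
  simp_rw [hdec]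
  calc _ ≤ ∫ ω, 3 * (4 * ((n : ℝ)⁻¹) ^ 2 * S₁ ω ^ 2 + ((n : ℝ)⁻¹) ^ 4 * S₂ ω ^ 2 + B ^ 2) ∂μ := by
        refine integral_mono
          (((hL₁.const_mul _).add ((hL₂.const_mul _).const_mul _)).add
            (memLp_const B)).integrable_sq
          ((hi.add (integrable_const _)).const_mul 3) fun ω => ?_
        simp only
        nlinarith [sq_nonneg (2 * (n : ℝ)⁻¹ * S₁ ω - (n : ℝ)⁻¹ * ((n : ℝ)⁻¹ * S₂ ω)),
          sq_nonneg (2 * (n : ℝ)⁻¹ * S₁ ω - B), sq_nonneg ((n : ℝ)⁻¹ * ((n : ℝ)⁻¹ * S₂ ω) - B)]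
    _ = 3 * (4 * ((n : ℝ)⁻¹) ^ 2 * ∫ ω, S₁ ω ^ 2 ∂μ
        + ((n : ℝ)⁻¹) ^ 4 * ∫ ω, S₂ ω ^ 2 ∂μ + B ^ 2) := by
        rw [integral_const_mul, integral_add hi (integrable_const _),
          integral_add (hL₁.integrable_sq.const_mul _) (hL₂.integrable_sq.const_mul _),
          integral_const_mul, integral_const_mul]
        simp
    _ ≤ 3 * (4 * ((n : ℝ)⁻¹) ^ 2 * (K₁ * (n * (2 * c n)))
        + ((n : ℝ)⁻¹) ^ 4 * (K₂ * (12 * c n * n) ^ 2) + ((L + 1) * K₃ * (1 / c n)) ^ 2) := by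
        gcongr
    _ = 3 * (8 * K₁ * (c n / n) + 144 * K₂ * (c n / n * (c n / n))
        + ((L + 1) * K₃) ^ 2 * (1 / c n) ^ 2) := by
        field_simp
        ring
    _ ≤ 3 * (8 * K₁ * (c n / n) + 144 * K₂ * (c n / n)
        + ((L + 1) * K₃) ^ 2 * (1 / c n) ^ 2) := by
        gcongr
        exact mul_le_of_le_one_left hcn0 hcn1
    _ ≤ _ := by
        have h1 : 0 ≤ K₁ * (1 / c n) ^ 2 := by positivity
        have h2 : 0 ≤ K₂ * (1 / c n) ^ 2 := by positivity
        have h3 : 0 ≤ ((L + 1) * K₃) ^ 2 * (c n / n) := by positivity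
        nlinarith

end MixingChain

end Chain

/-! ### Geometric ergodicity and choice of the bandwidth -/

theorem GeometricErgodic.exists_mixingChain {Ω X : Type*} [mΩ : MeasurableSpace Ω]
    [MeasurableSpace X] {μ : Measure Ω} {ℱ : Filtration ℕ mΩ}
    {P : Kernel X X} [IsMarkovKernel P] {π : Measure X} [IsProbabilityMeasure π]
    {ξ : ℕ → Ω → X} (hchain : IsMarkovChain μ ℱ P ξ) {V : X → ℝ}
    (hGE : GeometricErgodic μ P π ξ V) :
    ∃ C ρ M, MixingChain μ ℱ P π ξ (fun x => V x ^ (1 / 4 : ℝ)) C ρ M := by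
  have hV0 : ∀ x, 0 ≤ V x := fun x => zero_le_one.trans (hGE.one_le x)
  have hUm : ∀ β : ℝ, Measurable fun x => V x ^ β := fun β => hGE.measurable.pow_const β
  have hU1 : ∀ β : ℝ, 0 ≤ β → ∀ x, 1 ≤ V x ^ β := fun β hβ x =>
    Real.one_le_rpow (hGE.one_le x) hβ
  obtain ⟨C₁, ρ₁, h₁, h₁', hr₁⟩ := hGE.rate (1 / 4) (by norm_num) (by norm_num)
  obtain ⟨C₂, ρ₂, h₂, h₂', hr₂⟩ := hGE.rate (1 / 2) (by norm_num) (by norm_num)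
  have R₁ := GeometricRate.of_weightedDist (hUm _) (hU1 _ (by norm_num)) h₁ h₁' hr₁
  have R₂ := GeometricRate.of_weightedDist (hUm _) (hU1 _ (by norm_num)) h₂ h₂' hr₂
  -- The exponents `1 / 4` and `1 / 2` belong to `U = V ^ (1 / 4)` and its square; `U ^ 4 = V`.
  have e2 : (fun x => V x ^ (1 / 2 : ℝ)) = fun x => (V x ^ (1 / 4 : ℝ)) ^ 2 := by
    funext x
    rw [← Real.rpow_mul_natCast (hV0 x)]
    norm_num
  have e4 : ∀ x, (V x ^ (1 / 4 : ℝ)) ^ 4 = V x := by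
    intro x
    rw [← Real.rpow_mul_natCast (hV0 x)]
    norm_num
  rw [e2] at R₂
  have hρ : max ρ₁ ρ₂ < 1 := max_lt h₁' h₂'
  have hξ := hchain.measurable
  have hle : ∀ n, ∫⁻ ω, ENNReal.ofReal (V (ξ n ω)) ∂μ
      ≤ ⨆ n, ∫⁻ ω, ENNReal.ofReal (V (ξ n ω)) ∂μ := fun n =>
    le_iSup (fun n => ∫⁻ ω, ENNReal.ofReal (V (ξ n ω)) ∂μ) n
  refine ⟨_, _, (⨆ n, ∫⁻ ω, ENNReal.ofReal (V (ξ n ω)) ∂μ).toReal, hchain,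
    R₁.mono (le_max_left _ _) (le_max_left _ _) hρ,
    R₂.mono (le_max_right _ _) (le_max_right _ _) hρ, fun n => ?_, fun n => ?_⟩
  · refine (integrable_norm_rpow_iff ((hUm _).comp (hξ n)).aestronglyMeasurable
      (by norm_num) (by norm_num)).1 ?_
    refine ⟨?_, ?_⟩
    · exact (((hUm (1 / 4)).comp (hξ n)).norm.pow_const _).aestronglyMeasurable
    · have e : ∀ ω, ‖V (ξ n ω) ^ (1 / 4 : ℝ)‖ ^ (4 : ℝ≥0∞).toReal = V (ξ n ω) := by
        intro ω
        rw [Real.norm_of_nonneg (Real.rpow_nonneg (hV0 _) _), ENNReal.toReal_ofNat]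
        exact_mod_cast e4 (ξ n ω)
      change HasFiniteIntegral
        (fun ω => ‖V (ξ n ω) ^ (1 / 4 : ℝ)‖ ^ (4 : ℝ≥0∞).toReal) μ
      simp_rw [e]
      rw [hasFiniteIntegral_iff_ofReal (ae_of_all _ fun ω => hV0 _)]
      exact (hle n).trans_lt hGE.moment
  · simp_rw [e4]
    rw [integral_eq_lintegral_of_nonneg_ae (ae_of_all _ fun ω => hV0 _)
      (hGE.measurable.comp (hξ n)).aestronglyMeasurable]
    exact ENNReal.toReal_mono hGE.moment.ne (hle n)

theorem MemWeighted.exists_abs_le {X : Type*} [MeasurableSpace X] {V h : X → ℝ}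
    (hV : ∀ x, 1 ≤ V x) {δ β : ℝ} (hδ : δ ≤ β) (hh : MemWeighted (fun x => V x ^ δ) h) :
    ∃ b, 0 ≤ b ∧ ∀ x, |h x| ≤ b * V x ^ β := by
  obtain ⟨B, hB⟩ := hh.2
  refine ⟨max B 0, le_max_right _ _, fun x => ?_⟩
  have h1 : |h x| / V x ^ δ ≤ B := hB ⟨x, rfl⟩
  have hVδ : 0 < V x ^ δ := Real.rpow_pos_of_pos (zero_lt_one.trans_le (hV x)) _
  rw [div_le_iff₀ hVδ] at h1
  calc |h x| ≤ B * V x ^ δ := h1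
    _ ≤ max B 0 * V x ^ β :=
      mul_le_mul (le_max_left _ _) (Real.rpow_le_rpow_of_exponent_le (hV x) hδ) hVδ.le
        (le_max_right _ _)

/-- An eventual bound by a positive sequence holds everywhere after enlarging the constant. -/
theorem exists_forall_le_of_eventually {f g : ℕ → ℝ} {K : ℝ} (hg : ∀ n, 1 ≤ n → 0 < g n)
    (hK : ∀ᶠ n in atTop, f n ≤ K * g n) : ∃ K', ∀ n, 1 ≤ n → f n ≤ K' * g n := by
  obtain ⟨n₀, hn₀⟩ := eventually_atTop.1 hK
  refine ⟨max K (∑ n ∈ Finset.range n₀, |f n / g n|), fun n hn => ?_⟩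
  have hgn := hg n hn
  rcases le_or_gt n₀ n with h | h
  · exact (hn₀ n h).trans (mul_le_mul_of_nonneg_right (le_max_left _ _) hgn.le)
  · rw [← div_le_iff₀ hgn]
    refine (le_abs_self _).trans (le_trans ?_ (le_max_right _ _))
    exact Finset.single_le_sum (f := fun n => |f n / g n|) (fun _ _ => abs_nonneg _)
      (Finset.mem_range.2 h)

theorem tendsto_rpow_third : Tendsto (fun n : ℕ => (n : ℝ) ^ (1 / 3 : ℝ)) atTop atTop :=
  (tendsto_rpow_atTop (by norm_num)).comp tendsto_natCast_atTop_atTop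

theorem isLittleO_rpow_third :
    (fun n : ℕ => (n : ℝ) ^ (1 / 3 : ℝ)) =o[atTop] fun n : ℕ => (n : ℝ) := by
  have h : Tendsto (fun n : ℕ => (n : ℝ) ^ (-(2 / 3) : ℝ)) atTop (nhds 0) :=
    (tendsto_rpow_neg_atTop (by norm_num)).comp tendsto_natCast_atTop_atTop
  refine (Asymptotics.isLittleO_iff_tendsto' ?_).2 (h.congr' ?_)
  · filter_upwards [eventually_ge_atTop 1] with n hn h0
    exact absurd (Nat.cast_eq_zero.1 h0) (by omega)
  · filter_upwards [eventually_ge_atTop 1] with n hn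
    have hn0 : (0 : ℝ) < n := by exact_mod_cast hn
    rw [← Real.rpow_sub_one hn0.ne']
    norm_num

/-- At bandwidths within a factor two of `n ^ (1 / 3)` the bias and the standard deviation are
balanced. -/
theorem one_div_add_sqrt_le {c : ℝ} {n : ℕ} (hn : 1 ≤ n) (h1 : (n : ℝ) ^ (1 / 3 : ℝ) / 2 ≤ c)
    (h2 : c ≤ (n : ℝ) ^ (1 / 3 : ℝ)) :
    1 / c + Real.sqrt (c / n) ≤ 3 * (n : ℝ) ^ (-(1 / 3) : ℝ) := by
  have hn0 : (0 : ℝ) < n := by exact_mod_cast hn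
  set t := (n : ℝ) ^ (1 / 3 : ℝ) with ht
  have ht0 : 0 < t := Real.rpow_pos_of_pos hn0 _
  have ht3 : t ^ 3 = n := by
    rw [ht, ← Real.rpow_mul_natCast hn0.le]
    norm_num
  have e : (n : ℝ) ^ (-(1 / 3) : ℝ) = t⁻¹ := Real.rpow_neg hn0.le _
  have h3 : 1 / c ≤ 2 * t⁻¹ := by
    calc 1 / c ≤ 1 / (t / 2) := one_div_le_one_div_of_le (by positivity) h1
      _ = 2 * t⁻¹ := by field_simp
  have h4 : Real.sqrt (c / n) ≤ t⁻¹ := by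
    refine Real.sqrt_le_iff.2 ⟨by positivity, ?_⟩
    calc c / n ≤ t / n := by gcongr
      _ = t⁻¹ ^ 2 := by
        rw [← ht3]
        field_simp
  rw [e]
  linarith

end LagWindow

theorem theorem4p1 {Ω X : Type*} [mΩ : MeasurableSpace Ω] [MeasurableSpace X]
    (μ : Measure Ω) [IsProbabilityMeasure μ] (ℱ : Filtration ℕ mΩ)
    (P : Kernel X X) [IsMarkovKernel P] (π : Measure X) [IsProbabilityMeasure π]
    (hinv : P.Invariant π)
    (ξ : ℕ → Ω → X) (hchain : LagWindow.IsMarkovChain μ ℱ P ξ)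
    (V : X → ℝ) (hGE : LagWindow.GeometricErgodic μ P π ξ V)
    (w : ℝ → ℝ) (hw : LagWindow.IsWeight w)
    (hw_lip : ∃ L : ℝ, ∀ u : ℝ, |1 - w u| ≤ L * |u|)
    (δ : ℝ) (hδ0 : 0 ≤ δ) (hδ : δ < 1 / 4)
    (h : X → ℝ) (hh : LagWindow.MemWeighted (fun x => V x ^ δ) h)
    (hmean : ∫ x, h x ∂π = 0) (hvar : LagWindow.asympVar P π h = 1) :
    (∀ c : ℕ → ℝ, (∀ n, 1 ≤ n → 0 < c n) → Tendsto c atTop atTop →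
      c =o[atTop] (fun n : ℕ => (n : ℝ)) →
      ∃ K : ℝ, ∀ n : ℕ, 1 ≤ n →
        Integrable (fun ω => (LagWindow.lagWindowEst w c h ξ n ω - 1) ^ 2) μ ∧
        Real.sqrt (∫ ω, (LagWindow.lagWindowEst w c h ξ n ω - 1) ^ 2 ∂μ) ≤
          K * (1 / c n + Real.sqrt (c n / (n : ℝ)))) ∧
    (∀ c : ℕ → ℝ, ((∀ n : ℕ, 1 ≤ n → c n = (n : ℝ) ^ (1 / 3 : ℝ)) ∨
        (∀ n : ℕ, 1 ≤ n → c n = (⌊(n : ℝ) ^ (1 / 3 : ℝ)⌋₊ : ℝ))) →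
      ∃ K : ℝ, ∀ n : ℕ, 1 ≤ n →
        Integrable (fun ω => (LagWindow.lagWindowEst w c h ξ n ω - 1) ^ 2) μ ∧
        Real.sqrt (∫ ω, (LagWindow.lagWindowEst w c h ξ n ω - 1) ^ 2 ∂μ) ≤
          K * (n : ℝ) ^ (-(1 / 3) : ℝ)) := by
  obtain ⟨L, hL⟩ := hw_lip
  obtain ⟨C, ρ, M, H⟩ := hGE.exists_mixingChain hchain
  obtain ⟨b, hb, hhb⟩ := hh.exists_abs_le hGE.one_le hδ.le
  obtain ⟨K, hK, hmse⟩ :=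
    H.exists_integral_sq_lagWindowEst_sub_le hb hh.1 hhb hmean hvar hw hL
  have hint : ∀ (c : ℕ → ℝ) (n : ℕ),
      Integrable (fun ω => (LagWindow.lagWindowEst w c h ξ n ω - 1) ^ 2) μ := fun c n =>
    (H.memLp_lagWindowEst_sub hh.1 hhb w c n).integrable_sq
  have part1 : ∀ c : ℕ → ℝ, (∀ n, 1 ≤ n → 0 < c n) → Tendsto c atTop atTop →
      c =o[atTop] (fun n : ℕ => (n : ℝ)) →
      ∃ K : ℝ, ∀ n : ℕ, 1 ≤ n →
        Real.sqrt (∫ ω, (LagWindow.lagWindowEst w c h ξ n ω - 1) ^ 2 ∂μ) ≤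
          K * (1 / c n + Real.sqrt (c n / (n : ℝ))) := by
    intro c hc hctop hco
    refine LagWindow.exists_forall_le_of_eventually (K := Real.sqrt K) (fun n hn => ?_) ?_
    · have := hc n hn
      positivity
    -- The bound on the mean square error holds once `1 ≤ c n ≤ n`.
    · filter_upwards [hctop.eventually_ge_atTop 1, hco.bound one_pos, eventually_ge_atTop 1]
        with n h1 h2 hn
      have hn0 : (0 : ℝ) < n := by exact_mod_cast hn
      have hc0 := hc n hn
      rw [one_mul, Real.norm_of_nonneg hc0.le, Real.norm_of_nonneg hn0.le] at h2
      have hs : 0 ≤ 1 / c n + Real.sqrt (c n / n) := by positivity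
      rw [← Real.sqrt_sq hs, ← Real.sqrt_mul hK]
      refine Real.sqrt_le_sqrt ((hmse c n hn h1 h2).trans (mul_le_mul_of_nonneg_left ?_ hK))
      rw [add_sq, Real.sq_sqrt (by positivity)]
      have : 0 ≤ 2 * (1 / c n) * Real.sqrt (c n / n) := by positivity
      linarith
  refine ⟨fun c hc hctop hco => ?_, fun c hc => ?_⟩
  · obtain ⟨K', hK'⟩ := part1 c hc hctop hco
    exact ⟨K', fun n hn => ⟨hint c n, hK' n hn⟩⟩
  · have hbounds : ∀ n : ℕ, 1 ≤ n →
        (n : ℝ) ^ (1 / 3 : ℝ) / 2 ≤ c n ∧ c n ≤ (n : ℝ) ^ (1 / 3 : ℝ) := by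
      intro n hn
      have ht1 : 1 ≤ (n : ℝ) ^ (1 / 3 : ℝ) :=
        Real.one_le_rpow (by exact_mod_cast hn) (by norm_num)
      rcases hc with hc | hc
      · rw [hc n hn]
        constructor <;> linarith
      · rw [hc n hn]
        refine ⟨?_, Nat.floor_le (by linarith)⟩
        have h1 := Nat.lt_floor_add_one ((n : ℝ) ^ (1 / 3 : ℝ))
        have h2 : (1 : ℝ) ≤ ⌊(n : ℝ) ^ (1 / 3 : ℝ)⌋₊ := by
          exact_mod_cast Nat.le_floor (by exact_mod_cast ht1)
        linarith
    have hpos : ∀ n, 1 ≤ n → 0 < c n := fun n hn => by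
      have h1 : 0 < (n : ℝ) ^ (1 / 3 : ℝ) :=
        Real.rpow_pos_of_pos (by exact_mod_cast hn) _
      linarith [(hbounds n hn).1]
    have hctop : Tendsto c atTop atTop := by
      refine tendsto_atTop_mono' atTop ?_
        (LagWindow.tendsto_rpow_third.atTop_div_const zero_lt_two)
      filter_upwards [eventually_ge_atTop 1] with n hn using (hbounds n hn).1
    have hco : c =o[atTop] (fun n : ℕ => (n : ℝ)) := by
      refine Asymptotics.IsBigO.trans_isLittleO ?_ LagWindow.isLittleO_rpow_third
      refine Asymptotics.IsBigO.of_bound 1 ?_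
      filter_upwards [eventually_ge_atTop 1] with n hn
      rw [one_mul, Real.norm_of_nonneg (hpos n hn).le, Real.norm_of_nonneg (by positivity)]
      exact (hbounds n hn).2
    obtain ⟨K', hK'⟩ := part1 c hpos hctop hco
    refine ⟨|K'| * 3, fun n hn => ⟨hint c n, (hK' n hn).trans ?_⟩⟩
    have hs : 0 ≤ 1 / c n + Real.sqrt (c n / n) := by
      have := hpos n hn
      positivity
    calc K' * (1 / c n + Real.sqrt (c n / n))
        ≤ |K'| * (1 / c n + Real.sqrt (c n / n)) :=
          mul_le_mul_of_nonneg_right (le_abs_self K') hs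
      _ ≤ |K'| * (3 * (n : ℝ) ^ (-(1 / 3) : ℝ)) :=
          mul_le_mul_of_nonneg_left
            (LagWindow.one_div_add_sqrt_le hn (hbounds n hn).1 (hbounds n hn).2) (abs_nonneg K')
      _ = _ := by ring
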